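/- Let $V$ be a finite-dimensional real vector space and let $\mathbb{P}(V)$ be its projective space, with the quotient topology from $V\setminus\{0\}$. For $A\in\operatorname{End}(V)$ let $\psi_A$ be the projective flow $\psi_A(t,[x])=[\mathrm{e}^{tA}x]$ on $\mathbb{P}(V)$. Let $A,B\in\operatorname{End}(V)$, and suppose there is a topological conjugacy from $\psi_A$ to $\psi_B$, that is, a homeomorphism $h:\mathbb{P}(V)\to\mathbb{P}(V)$ with $h(\psi_A(t,p))=\psi_B(t,h(p))$ for all $t\in\mathbb{R}$ and $p\in\mathbb{P}(V)$. Then there are an integer $k\ge 0$, integers $d_1,\dots,d_k\ge 1$, real numbers $\lambda_1>\cdots>\lambda_k$ and $\mu_1>\cdots>\mu_k$, and endomorphisms $\sigma_i(A),\sigma_i(B)$ of $\mathbb{R}^{d_i}$ $(i=1,\dots,k)$, all of whose complex eigenvalues lie on the imaginary axis, such that, with respect to suitable linear isomorphisms $P,Q:V\to\mathbb{R}^{d_1}\oplus\cdots\oplus\mathbb{R}^{d_k}$ (one for $A$ and one for $B$), $$PAP^{-1}=(\lambda_1\operatorname{id}+\sigma_1(A))\oplus\cdots\oplus(\lambda_k\operatorname{id}+\sigma_k(A)),$$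 $$QBQ^{-1}=(\mu_1\operatorname{id}+\sigma_1(B))\oplus\cdots\oplus(\mu_k\operatorname{id}+\sigma_k(B)).$$ -/

import Mathlib

open scoped LinearAlgebra.Projectivization

noncomputable section

namespace ProjFlow

variable {V : Type*} [NormedAddCommGroup V] [NormedSpace ℝ V]

/-- The projective space `ℙ ℝ V` carries the quotient topology of `V \ {0}`. -/
instance : TopologicalSpace (ℙ ℝ V) :=
  inferInstanceAs (TopologicalSpace (Quotient (projectivizationSetoid ℝ V)))

/-- The projection `V \ {0} → ℙ ℝ V` is an open quotient map. -/
theorem isOpenQuotientMap_mk' :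
    IsOpenQuotientMap (Projectivization.mk' ℝ : {v : V // v ≠ 0} → ℙ ℝ V) := by
  refine ⟨Quotient.mk''_surjective, continuous_quotient_mk', ?_⟩
  intro U hU
  have hq : Topology.IsQuotientMap (Projectivization.mk' ℝ : {v : V // v ≠ 0} → ℙ ℝ V) :=
    isQuotientMap_quotient_mk'
  rw [← hq.isOpen_preimage]
  have hset : (Projectivization.mk' ℝ : {v : V // v ≠ 0} → ℙ ℝ V) ⁻¹'
      ((Projectivization.mk' ℝ : {v : V // v ≠ 0} → ℙ ℝ V) '' U) =
      ⋃ a : ℝˣ, (fun v : {v : V // v ≠ 0} =>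
        (⟨a • (v : V), (smul_ne_zero_iff_ne a).2 v.2⟩ : {v : V // v ≠ 0})) ⁻¹' U := by
    ext v
    simp only [Set.mem_preimage, Set.mem_image, Set.mem_iUnion]
    constructor
    · rintro ⟨u, hu, huv⟩
      obtain ⟨a, ha⟩ := (Projectivization.mk_eq_mk_iff ℝ _ _ u.2 v.2).1 huv
      exact ⟨a, by convert hu⟩
    · rintro ⟨a, ha⟩
      exact ⟨_, ha, (Projectivization.mk_eq_mk_iff ℝ _ _ _ v.2).2 ⟨a, rfl⟩⟩
  rw [hset]
  refine isOpen_iUnion fun a => hU.preimage ?_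
  exact Continuous.subtype_mk (continuous_subtype_val.const_smul a) _

variable [FiniteDimensional ℝ V]

/-- The time-`t` map `x ↦ exp (t A) x` of the linear flow of `A`. -/
def expMap (A : Module.End ℝ V) (t : ℝ) : V →L[ℝ] V :=
  NormedSpace.exp (t • LinearMap.toContinuousLinearMap A)

theorem expMap_zero (A : Module.End ℝ V) : expMap A 0 = 1 := by
  simp [expMap]

theorem expMap_add (A : Module.End ℝ V) (s t : ℝ) :
    expMap A (s + t) = expMap A s * expMap A t := by
  have : CompleteSpace V := FiniteDimensional.complete ℝ V
  let _ : NormedAlgebra ℚ (V →L[ℝ] V) := NormedAlgebra.restrictScalars ℚ ℝ _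
  rw [expMap, add_smul, NormedSpace.exp_add_of_commute]
  · rfl
  · exact ((Commute.refl _).smul_left s).smul_right t

theorem continuous_expMap (A : Module.End ℝ V) : Continuous (expMap A) := by
  have : CompleteSpace V := FiniteDimensional.complete ℝ V
  let _ : NormedAlgebra ℚ (V →L[ℝ] V) := NormedAlgebra.restrictScalars ℚ ℝ _
  exact NormedSpace.exp_continuous.comp (continuous_id.smul continuous_const)

theorem expMap_injective (A : Module.End ℝ V) (t : ℝ) :
    Function.Injective ((expMap A t : V →L[ℝ] V) : V →ₗ[ℝ] V) := by
  refine Function.LeftInverse.injective (g := expMap A (-t)) fun x => ?_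
  have h : (expMap A (-t) * expMap A t) x = x := by
    rw [← expMap_add, neg_add_cancel, expMap_zero]; rfl
  exact h

/-- The projective flow `ψ_A` on `ℙ ℝ V`, given by `ψ_A (t, [x]) = [exp (t A) x]`. -/
def projectiveFlow (A : Module.End ℝ V) : Flow ℝ (ℙ ℝ V) where
  toFun t := Projectivization.map ((expMap A t : V →L[ℝ] V) : V →ₗ[ℝ] V) (expMap_injective A t)
  cont' := by
    have hq := (IsOpenQuotientMap.id (X := ℝ)).prodMap (isOpenQuotientMap_mk' (V := V))
    rw [hq.isQuotientMap.continuous_iff]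
    refine (isOpenQuotientMap_mk' (V := V)).continuous.comp
      (Continuous.subtype_mk (f := fun p : ℝ × {v : V // v ≠ 0} => expMap A p.1 (p.2 : V)) ?_
        fun p hp => p.2.2 (expMap_injective A p.1 (hp.trans (map_zero _).symm)))
    exact ((continuous_expMap A).comp continuous_fst).clm_apply
      (continuous_subtype_val.comp continuous_snd)
  map_add' s t p := by
    induction p using Projectivization.ind with | h v hv =>
    simp only [Projectivization.map_mk]
    congr 1
    simp [expMap_add]
  map_zero' p := by
    induction p using Projectivization.ind with | h v hv =>
    simp [Projectivization.map_mk, expMap_zero]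

/-- `h` is a topological conjugacy from the flow `φ₁` to the flow `φ₂`. -/
def IsTopConjugacy {X Y : Type*} [TopologicalSpace X] [TopologicalSpace Y]
    (φ₁ : Flow ℝ X) (φ₂ : Flow ℝ Y) (h : X ≃ₜ Y) : Prop :=
  ∀ (t : ℝ) (x : X), h (φ₁ t x) = φ₂ t (h x)

/-- All complex eigenvalues of the real endomorphism `σ` lie on the imaginary axis. -/
def HasImaginarySpectrum {W : Type*} [AddCommGroup W] [Module ℝ W] (σ : Module.End ℝ W) : Prop :=
  ∀ z : ℂ, Module.End.HasEigenvalue (LinearMap.baseChange ℂ σ) z → z.re = 0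

end ProjFlow

end

noncomputable section

/-! ### Invariance of dimension, by an integral form of degree theory -/

namespace ProjFlow

open MeasureTheory Metric Set Polynomial

/-! The order of the real parts of the eigenvalues and the dimensions of their blocks can be read
off from the topology of the projective flow. Split `V` into the sums `V_a` of generalized
eigenspaces with real part `a`. For nonzero `x` in `V_a`, the trajectory divided by `exp (a t) t ^
r` is asymptotic, as `t` tends to `±∞`, to a nowhere zero continuous function of phases on a torus
(`exists_exp_asymptotics`). Two facts follow. For general `x`, the forward limit points of `[x]` lie
in `ℙ(V_a)` with `a` the largest exponent occurring in `x`, the backward ones in that of the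
smallest. And each point of `ℙ(V_a)` has a common forward and backward limit point, since the phases
return to `1` along some times `±τ n`.

Hence the union of the `ℙ(V_a)` is exactly `biRecurrentSet`, which a conjugacy preserves. The pieces
are finitely many, closed, disjoint and connected, so they are matched with those of `B`
(`exists_mapsTo_linearSet`). Moreover `b ≤ a` exactly when some orbit runs from `ℙ(V_b)` to `ℙ(V_a)`
(`le_iff_exists_limitsIn`), so the matching is monotone. It preserves dimensions because a ball has
no continuous injection into a space of smaller dimension (`not_injOn_closedBall_of_finrank_lt`).
The rest is linear algebra, as nothing else relates the blocks of `A` to those of `B`. -/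

theorem integral_eval_eq_of_nodes {α : Type*} [MeasurableSpace α] {μ : Measure α} {D : ℕ}
    {p : α → ℝ[X]} (hp : ∀ x, (p x).natDegree ≤ D)
    (hint : ∀ t : ℝ, Integrable (fun x => (p x).eval t) μ) {δ c : ℝ} (hδ : 0 < δ)
    (hc : ∀ t : ℝ, 0 < t → t < δ → ∫ x, (p x).eval t ∂μ = c) (s : ℝ) :
    ∫ x, (p x).eval s ∂μ = c := by
  -- These `D + 1` nodes lie strictly inside `(0, δ)`. Interpolation makes the integral at `s` a
  -- combination of the integrals at the nodes, with weights of sum `1`.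
  let v : ℕ → ℝ := fun j => δ / (j + 2)
  have hv : Set.InjOn v (Finset.range (D + 1)) := by
    intro i _ j _ hij
    have h1 : δ / ((i : ℝ) + 2) = δ / (j + 2) := hij
    rw [div_eq_div_iff (by positivity) (by positivity)] at h1
    have := mul_left_cancel₀ hδ.ne' h1
    exact_mod_cast (add_right_cancel this).symm
  have key : ∀ x, (p x).eval s = ∑ j ∈ Finset.range (D + 1),
      (p x).eval (v j) * (Lagrange.basis (Finset.range (D + 1)) v j).eval s := by
    intro x
    have h := Lagrange.eq_interpolate (f := p x) hv (by
      rw [Finset.card_range]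
      exact lt_of_le_of_lt (degree_le_natDegree) (by exact_mod_cast Nat.lt_succ_of_le (hp x)))
    conv_lhs => rw [h]
    simp [Lagrange.interpolate_apply, eval_finsetSum]
  simp_rw [key]
  rw [integral_finsetSum _ fun j _ => (hint _).mul_const _]
  simp_rw [integral_mul_const]
  have h2 : ∀ j, ∫ x, (p x).eval (v j) ∂μ = c := by
    intro j
    have h3 : (0:ℝ) ≤ j := Nat.cast_nonneg j
    refine hc _ (by positivity) ?_
    exact div_lt_self hδ (by linarith)
  simp_rw [h2]
  rw [← Finset.mul_sum, ← eval_finsetSum, Lagrange.sum_basis hv ⟨0, by simp⟩]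
  simp

theorem exists_polynomial_det_one_add_smul {E : Type*} [NormedAddCommGroup E] [NormedSpace ℝ E]
    [FiniteDimensional ℝ E] (M : E →L[ℝ] E) :
    ∃ p : ℝ[X], p.natDegree ≤ Module.finrank ℝ E ∧ ∀ t : ℝ, p.eval t = (1 + t • M).det := by
  let b := Module.finBasis ℝ E
  let A := LinearMap.toMatrix b b (M : E →ₗ[ℝ] E)
  refine ⟨((X : ℝ[X]) • A.map C + (1 : Matrix _ _ ℝ).map C).det, ?_, fun t => ?_⟩
  · simpa using natDegree_det_X_add_C_le A 1
  · have hM : ((1 + t • M : E →L[ℝ] E) : E →ₗ[ℝ] E) = 1 + t • (M : E →ₗ[ℝ] E) := rfl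
    rw [ContinuousLinearMap.det, hM, ← LinearMap.det_toMatrix b, ← coe_evalRingHom,
      RingHom.map_det]
    congr 1
    ext i j
    rcases eq_or_ne i j with rfl | hij
    · simp [A, LinearMap.toMatrix_one, add_comm, mul_comm t]
    · simp [A, hij, LinearMap.toMatrix_one, mul_comm t]

theorem image_eq_of_bijective_of_eqOn_compl {α : Type*} {f : α → α} (hf : Function.Bijective f)
    {s : Set α} (h : ∀ x ∉ s, f x = x) : f '' s = s := by
  ext y
  constructor
  · rintro ⟨x, hx, rfl⟩
    by_contra hy
    exact hy (by rwa [hf.1 (h _ hy)])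
  · intro hy
    obtain ⟨x, rfl⟩ := hf.2 y
    by_cases hx : x ∈ s
    · exact ⟨x, hx, rfl⟩
    · exact absurd (by rwa [h x hx] at hy) hx

/-- A compactly supported `C¹` map is Lipschitz, so for small `t` the perturbation `t • g` has
Lipschitz constant below `1` and its derivative is close to `0`. -/
theorem exists_perturbation_bijective {E : Type*} [NormedAddCommGroup E] [NormedSpace ℝ E]
    [FiniteDimensional ℝ E] {g : E → E} (hg : ContDiff ℝ 1 g) (hgs : HasCompactSupport g) :
    ∃ δ : ℝ, 0 < δ ∧ ∀ t : ℝ, 0 < t → t < δ →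
      Function.Bijective (fun x => x + t • g x) ∧ ∀ x, 0 < (1 + t • fderiv ℝ g x).det := by
  have : CompleteSpace E := FiniteDimensional.complete ℝ E
  obtain ⟨K, hK⟩ := hg.lipschitzWith_of_hasCompactSupport hgs one_ne_zero
  have hdet : ∀ᶠ M : E →L[ℝ] E in nhds 1, 0 < M.det := by
    refine (ContinuousLinearMap.continuous_det.tendsto (1 : E →L[ℝ] E)).eventually
      (lt_mem_nhds ?_)
    have : (1 : E →L[ℝ] E).det = 1 := by
      have hM : ((1 : E →L[ℝ] E) : E →ₗ[ℝ] E) = LinearMap.id := rfl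
      rw [ContinuousLinearMap.det, hM, LinearMap.det_id]
    rw [this]; exact one_pos
  obtain ⟨ε, hε, hdet⟩ := Metric.eventually_nhds_iff.1 hdet
  have hK1 : (0:ℝ) < K + 1 := by positivity
  refine ⟨min ε 1 / (K + 1), by positivity, fun t ht0 ht => ?_⟩
  rw [lt_div_iff₀ hK1] at ht
  have ht1 : t * K < 1 := by have := min_le_right ε 1; nlinarith
  have ht2 : t * K < ε := by have := min_le_left ε 1; nlinarith
  constructor
  · have ha : ApproximatesLinearOn (fun x => x + t • g x)
        ((ContinuousLinearEquiv.refl ℝ E : E ≃L[ℝ] E) : E →L[ℝ] E) univ (t.toNNReal * K) := by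
      intro x _ y _
      have : x + t • g x - (y + t • g y) - (x - y) = t • (g x - g y) := by
        rw [smul_sub]; abel
      simp only [ContinuousLinearEquiv.coe_coe, ContinuousLinearEquiv.refl_apply, this, norm_smul,
        NNReal.coe_mul, Real.coe_toNNReal _ ht0.le, Real.norm_of_nonneg ht0.le, mul_assoc]
      gcongr
      exact hK.norm_sub_le x y
    have hc : Subsingleton E ∨ t.toNNReal * K < ‖(((ContinuousLinearEquiv.refl ℝ E).symm :
        E ≃L[ℝ] E) : E →L[ℝ] E)‖₊⁻¹ := by
      rcases subsingleton_or_nontrivial E with h | h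
      · exact Or.inl h
      · right
        have h1 : ‖(((ContinuousLinearEquiv.refl ℝ E).symm : E ≃L[ℝ] E) : E →L[ℝ] E)‖₊ = 1 := by
          ext; exact ContinuousLinearMap.norm_id
        rw [h1, inv_one, ← NNReal.coe_lt_coe]
        simpa [ht0.le] using ht1
    exact ⟨injOn_univ.1 (injOn_iff_injective.2 (ha.injective hc)), ha.surjective hc⟩
  · intro x
    apply hdet
    rw [dist_eq_norm, add_sub_cancel_left, norm_smul, Real.norm_of_nonneg ht0.le]
    refine lt_of_le_of_lt ?_ ht2
    gcongr
    exact norm_fderiv_le_of_lipschitz ℝ hK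

/-- The degree of a compactly supported perturbation of the identity, tested against powers of
`4 - ‖y‖²`. -/
theorem setIntegral_pow_mul_det_eq {E : Type*} [NormedAddCommGroup E] [InnerProductSpace ℝ E]
    [FiniteDimensional ℝ E] [MeasurableSpace E] [BorelSpace E] (μ : Measure E)
    [μ.IsAddHaarMeasure] {g : E → E} (hg : ContDiff ℝ 1 g)
    (hgs : ∀ x ∉ closedBall (0 : E) 1, g x = 0) (N : ℕ) :
    ∫ x in closedBall (0 : E) 1, (4 - ‖x + g x‖ ^ 2) ^ N * (1 + fderiv ℝ g x).det ∂μ =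
      ∫ x in closedBall (0 : E) 1, (4 - ‖x‖ ^ 2) ^ N ∂μ := by
  have hcs : HasCompactSupport g :=
    HasCompactSupport.intro (isCompact_closedBall (0 : E) 1) hgs
  obtain ⟨δ, hδ, hδ'⟩ := exists_perturbation_bijective hg hcs
  choose q hqd hq using fun x => exists_polynomial_det_one_add_smul (fderiv ℝ g x)
  let w : E → ℝ[X] := fun x =>
    C (4 - ‖x‖ ^ 2) - C (2 * inner ℝ x (g x)) * X - C (‖g x‖ ^ 2) * X ^ 2
  have hw : ∀ x (t : ℝ), (w x).eval t = 4 - ‖x + t • g x‖ ^ 2 := by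
    intro x t
    simp only [w, eval_sub, eval_C, eval_mul, eval_X, eval_pow]
    rw [norm_add_sq_real, inner_smul_right, norm_smul, mul_pow, Real.norm_eq_abs, sq_abs]
    ring
  have hwd : ∀ x, (w x).natDegree ≤ 2 := by
    intro x
    simp only [w]
    compute_degree
  -- With `t • g` in place of `g` the integrand is polynomial in `t`. For small `t` the map is a
  -- bijection of the ball, and the change of variables gives the asserted value; polynomiality
  -- carries it to `t = 1`, where injectivity may fail.
  have h := integral_eval_eq_of_nodes (μ := μ.restrict (closedBall (0 : E) 1))
    (p := fun x => w x ^ N * q x) (D := N * 2 + Module.finrank ℝ E) (δ := δ)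
    (c := ∫ x in closedBall (0 : E) 1, (4 - ‖x‖ ^ 2) ^ N ∂μ) ?_ ?_ hδ ?_ 1
  · simpa [hw, hq] using h
  · intro x
    refine natDegree_mul_le.trans (add_le_add ?_ (hqd x))
    exact natDegree_pow_le.trans (Nat.mul_le_mul_left _ (hwd x))
  · intro t
    simp only [eval_mul, eval_pow, hw, hq]
    refine ContinuousOn.integrableOn_compact (isCompact_closedBall _ _) (Continuous.continuousOn ?_)
    have h1 : Continuous fun x => (1 + t • fderiv ℝ g x).det :=
      ContinuousLinearMap.continuous_det.comp
        (continuous_const.add ((hg.continuous_fderiv one_ne_zero).const_smul t))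
    have := hg.continuous
    fun_prop
  · intro t ht0 ht
    obtain ⟨hbij, hpos⟩ := hδ' t ht0 ht
    have himg := image_eq_of_bijective_of_eqOn_compl hbij (s := closedBall (0 : E) 1)
      (fun x hx => by simp [hgs x hx])
    have hcv := integral_image_eq_integral_abs_det_fderiv_smul μ
      (measurableSet_closedBall (x := (0 : E)) (ε := 1))
      (f := fun x => x + t • g x) (f' := fun x => 1 + t • fderiv ℝ g x)
      (fun x _ => ((hasFDerivAt_id x).add
        (((hg.differentiable one_ne_zero) x).hasFDerivAt.const_smul t)).hasFDerivWithinAt)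
      hbij.1.injOn (fun y => (4 - ‖y‖ ^ 2) ^ N)
    rw [himg] at hcv
    rw [hcv]
    refine integral_congr_ae (Filter.Eventually.of_forall fun x => ?_)
    simp only [eval_mul, eval_pow, hw, hq, abs_of_pos (hpos x), smul_eq_mul]
    ring

/-- A map close to the identity has degree one and cannot be singular everywhere. Cut off to `x + g
x`, it agrees with `φ` near the origin, so the determinant there would vanish; elsewhere `x + g x`
stays away from `0`, where the weight `4 - ‖y‖²` is not maximal. High powers of the weight then
contradict the degree formula. -/
theorem exists_det_fderiv_ne_zero {E : Type*} [NormedAddCommGroup E] [InnerProductSpace ℝ E]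
    [FiniteDimensional ℝ E] {φ : E → E} (hφ : ContDiff ℝ 1 φ)
    (h : ∀ x ∈ closedBall (0 : E) 1, ‖φ x - x‖ ≤ 1 / 8) : ∃ x, (fderiv ℝ φ x).det ≠ 0 := by
  by_contra! hdet
  let _ : MeasurableSpace E := borel E
  have _ : BorelSpace E := ⟨rfl⟩
  let μ : Measure E := Measure.addHaar
  let χ : ContDiffBump (0 : E) := ⟨1 / 2, 1, by norm_num, by norm_num⟩
  let g : E → E := fun x => χ x • (φ x - x)
  have hg : ContDiff ℝ 1 g := (χ.contDiff (n := 1)).smul (hφ.sub contDiff_id)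
  have hgs : ∀ x ∉ closedBall (0 : E) 1, g x = 0 := by
    intro x hx
    have : χ x = 0 := χ.zero_of_le_dist (le_of_lt (by simpa using hx))
    simp [g, this]
  have hgb : ∀ x ∈ closedBall (0 : E) 1, ‖g x‖ ≤ 1 / 8 := by
    intro x hx
    simp only [g, norm_smul, Real.norm_of_nonneg χ.nonneg]
    calc χ x * ‖φ x - x‖ ≤ 1 * (1 / 8) :=
          mul_le_mul χ.le_one (h x hx) (norm_nonneg _) zero_le_one
      _ = 1 / 8 := one_mul _
  have hdc : Continuous fun x => (1 + fderiv ℝ g x).det :=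
    ContinuousLinearMap.continuous_det.comp
      (continuous_const.add (hg.continuous_fderiv one_ne_zero))
  obtain ⟨K, hK⟩ := (isCompact_closedBall (0 : E) 1).exists_bound_of_continuousOn hdc.continuousOn
  have hK0 : 0 ≤ K := (norm_nonneg _).trans (hK 0 (by simp))
  have hzero : ∀ x ∈ ball (0 : E) (1 / 2), (1 + fderiv ℝ g x).det = 0 := by
    intro x hx
    have hev : g =ᶠ[nhds x] fun y => φ y - y := by
      filter_upwards [isOpen_ball.mem_nhds hx] with y hy
      have : χ y = 1 := χ.one_of_mem_closedBall (ball_subset_closedBall hy)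
      simp [g, this]
    have hd : HasFDerivAt (fun y => φ y - y) (fderiv ℝ φ x - 1) x :=
      ((hφ.differentiable one_ne_zero) x).hasFDerivAt.sub (hasFDerivAt_id x)
    rw [hev.fderiv_eq, hd.fderiv, add_sub_cancel, hdet]
  -- Where the determinant may be nonzero, `‖x + g x‖ ≥ 1/2 - 1/8 = 3/8`, and `4 - (3/8)² = 247/64`.
  -- Below, `252/64 = 4 - (1/4)²`.
  have hupper : ∀ (N : ℕ), ∀ x ∈ closedBall (0 : E) 1,
      ‖(4 - ‖x + g x‖ ^ 2) ^ N * (1 + fderiv ℝ g x).det‖ ≤ (247 / 64) ^ N * K := by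
    intro N x hx
    by_cases hx2 : x ∈ ball (0 : E) (1 / 2)
    · rw [hzero x hx2, mul_zero, norm_zero]; positivity
    · rw [norm_mul, norm_pow]
      have h1 : 1 / 2 ≤ ‖x‖ := by simpa using hx2
      have h2 : ‖x‖ ≤ 1 := by simpa using hx
      have h3 := hgb x hx
      have h4 : ‖x + g x‖ ≤ 9 / 8 := (norm_add_le _ _).trans (by linarith)
      have h5 : 3 / 8 ≤ ‖x + g x‖ := by
        have := norm_sub_le (x + g x) (g x)
        rw [add_sub_cancel_right] at this
        linarith
      have h6 : ‖4 - ‖x + g x‖ ^ 2‖ ≤ 247 / 64 := by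
        rw [Real.norm_eq_abs, abs_le]; constructor <;> nlinarith
      exact mul_le_mul (pow_le_pow_left₀ (norm_nonneg _) h6 N) (hK x hx) (norm_nonneg _)
        (by positivity)
  have hfin : μ (closedBall (0 : E) 1) < ⊤ := (isCompact_closedBall _ _).measure_lt_top
  have hineq : ∀ N : ℕ, (252 / 64 : ℝ) ^ N * μ.real (ball (0 : E) (1 / 4)) ≤
      (247 / 64) ^ N * K * μ.real (closedBall (0 : E) 1) := by
    intro N
    have h1 := norm_setIntegral_le_of_norm_le_const hfin (hupper N)
    rw [setIntegral_pow_mul_det_eq μ hg hgs N] at h1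
    refine le_trans ?_ ((le_abs_self _).trans h1)
    have hpos : ∀ x ∈ closedBall (0 : E) 1, (0:ℝ) ≤ 4 - ‖x‖ ^ 2 := by
      intro x hx
      have h2 : ‖x‖ ≤ 1 := by simpa using hx
      nlinarith [norm_nonneg x]
    have hint : IntegrableOn (fun x : E => (4 - ‖x‖ ^ 2) ^ N) (closedBall (0 : E) 1) μ :=
      ContinuousOn.integrableOn_compact (isCompact_closedBall _ _)
        (Continuous.continuousOn (by fun_prop))
    have hsub : ball (0 : E) (1 / 4) ⊆ closedBall 0 1 :=
      ball_subset_closedBall.trans (closedBall_subset_closedBall (by norm_num))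
    calc (252 / 64 : ℝ) ^ N * μ.real (ball (0 : E) (1 / 4))
        = ∫ _ in ball (0 : E) (1 / 4), (252 / 64 : ℝ) ^ N ∂μ := by
          rw [setIntegral_const, smul_eq_mul, mul_comm]
      _ ≤ ∫ x in ball (0 : E) (1 / 4), (4 - ‖x‖ ^ 2) ^ N ∂μ := by
          refine setIntegral_mono_on (integrableOn_const ?_) (hint.mono_set hsub)
            measurableSet_ball fun x hx => ?_
          · exact (measure_mono hsub |>.trans_lt hfin).ne
          · have h2 : ‖x‖ < 1 / 4 := by simpa using hx
            refine pow_le_pow_left₀ (by norm_num) ?_ N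
            nlinarith [norm_nonneg x]
      _ ≤ ∫ x in closedBall (0 : E) 1, (4 - ‖x‖ ^ 2) ^ N ∂μ := by
          refine setIntegral_mono_set hint ?_ (Filter.Eventually.of_forall hsub)
          exact (ae_restrict_iff' measurableSet_closedBall).2
            (Filter.Eventually.of_forall fun x hx => pow_nonneg (hpos x hx) N)
  have hb : 0 < μ.real (ball (0 : E) (1 / 4)) :=
    ENNReal.toReal_pos (measure_ball_pos μ _ (by norm_num)).ne' (measure_ball_lt_top).ne
  obtain ⟨N, hN⟩ := pow_unbounded_of_one_lt
    (K * μ.real (closedBall (0 : E) 1) / μ.real (ball (0 : E) (1 / 4)))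
    (show (1:ℝ) < 252 / 247 by norm_num)
  rw [div_lt_iff₀ hb] at hN
  have h247 : (0:ℝ) < (247 / 64) ^ N := by positivity
  have := mul_lt_mul_of_pos_left hN h247
  have h1 : (247 / 64 : ℝ) ^ N * (252 / 247) ^ N = (252 / 64) ^ N := by
    rw [← mul_pow]; norm_num
  rw [← mul_assoc, ← mul_assoc, h1] at this
  exact absurd (hineq N) (not_le.2 this)

/-- There is no continuous injection of a ball into a space of smaller dimension. -/
theorem not_injOn_closedBall_of_finrank_lt {E F : Type*} [NormedAddCommGroup E]
    [InnerProductSpace ℝ E] [FiniteDimensional ℝ E] [NormedAddCommGroup F] [NormedSpace ℝ F]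
    [FiniteDimensional ℝ F] (hEF : Module.finrank ℝ F < Module.finrank ℝ E) {f : E → F}
    (hf : ContinuousOn f (closedBall 0 1)) : ¬ InjOn f (closedBall 0 1) := by
  intro hinj
  let B := closedBall (0 : E) 1
  have hBc : IsCompact B := isCompact_closedBall _ _
  have : CompactSpace B := isCompact_iff_compactSpace.1 hBc
  obtain ⟨f₁, hf₁⟩ := ContinuousMap.exists_restrict_eq (isClosed_closedBall (x := (0:E)) (ε := 1))
    ⟨B.domRestrict f, hf.domRestrict⟩
  have hf₁' : ∀ x ∈ B, f₁ x = f x := fun x hx => congrArg (fun k => k ⟨x, hx⟩) hf₁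
  have hemb : Topology.IsClosedEmbedding (fun x : B => f₁ x) := by
    refine Continuous.isClosedEmbedding (f₁.continuous.comp continuous_subtype_val) ?_
    intro x y hxy
    exact Subtype.ext (hinj x.2 y.2 (by rw [← hf₁' _ x.2, ← hf₁' _ y.2]; exact hxy))
  -- By Tietze the inverse of `f` extends to all of `F`. Smooth approximations `G` of it and `f₂` of
  -- `f` give `G ∘ f₂` within `1/16 + 1/16` of the identity, yet its derivative factors through the
  -- smaller space `F`.
  obtain ⟨g, hg⟩ := ContinuousMap.exists_extension hemb ⟨Subtype.val, continuous_subtype_val⟩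
  have hg' : ∀ x ∈ B, g (f₁ x) = x := fun x hx => congrArg (fun k => k ⟨x, hx⟩) hg
  obtain ⟨G, hG, hGg, -⟩ := g.continuous.exists_contDiff_approx (ε := fun _ => 1 / 16) 1
    continuous_const (fun _ => by norm_num)
  obtain ⟨ρ, hρ, hρ'⟩ : ∃ ρ > 0, ∀ x ∈ B, ∀ y, dist y (f₁ x) < ρ → dist (G y) (G (f₁ x)) < 1 / 16 := by
    have hu := (hBc.image f₁.continuous).uniformContinuousAt_of_continuousAt G
      (fun _ _ => hG.continuous.continuousAt) (dist_mem_uniformity (show (0:ℝ) < 1 / 16 by norm_num))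
    obtain ⟨ρ, hρ, hu⟩ := Metric.mem_uniformity_dist.1 hu
    refine ⟨ρ, hρ, fun x hx y hy => ?_⟩
    rw [dist_comm] at hy ⊢
    exact hu hy (mem_image_of_mem _ hx)
  obtain ⟨f₂, hf₂, hf₂', -⟩ := f₁.continuous.exists_contDiff_approx (ε := fun _ => ρ) 1
    continuous_const (fun _ => hρ)
  obtain ⟨x, hx⟩ := exists_det_fderiv_ne_zero (φ := G ∘ f₂) (hG.comp hf₂) (by
    intro x hx
    rw [← dist_eq_norm]
    have h1 := hρ' x hx (f₂ x) (hf₂' x)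
    have h2 := hGg (f₁ x)
    rw [hg' x hx] at h2
    have h3 := dist_triangle (G (f₂ x)) (G (f₁ x)) x
    simp only [Function.comp]
    linarith)
  rw [fderiv_comp x ((hG.differentiable one_ne_zero) _) ((hf₂.differentiable one_ne_zero) _),
    ContinuousLinearMap.det, Ne, LinearMap.det_eq_zero_iff_ker_ne_bot, not_not,
    LinearMap.ker_eq_bot] at hx
  refine absurd (LinearMap.finrank_le_finrank_of_injective
    (f := (fderiv ℝ f₂ x : E →ₗ[ℝ] F)) ?_) (not_le.2 hEF)
  exact Function.Injective.of_comp (f := fderiv ℝ G (f₂ x)) hx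

end ProjFlow

/-! ### Splitting by the real parts of the eigenvalues -/

namespace ProjFlow

open Polynomial

/-- All complex roots of `p` have real part `a`. -/
def RootsOnLine (p : ℝ[X]) (a : ℝ) : Prop := ∀ z : ℂ, aeval z p = 0 → z.re = a

theorem RootsOnLine.mul {p q : ℝ[X]} {a : ℝ} (hp : RootsOnLine p a) (hq : RootsOnLine q a) :
    RootsOnLine (p * q) a := by
  intro z hz
  rw [map_mul, mul_eq_zero] at hz
  exact hz.elim (hp z) (hq z)

theorem rootsOnLine_one (a : ℝ) : RootsOnLine 1 a := by
  intro z hz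
  simp at hz

theorem RootsOnLine.isCoprime {p q : ℝ[X]} {a b : ℝ} (hp : RootsOnLine p a)
    (hq : RootsOnLine q b) (hab : a ≠ b) : IsCoprime p q := by
  rw [isCoprime_iff_aeval_ne_zero_of_isAlgClosed ℝ ℂ]
  intro z
  by_contra! h
  exact hab ((hp z h.1).symm.trans (hq z h.2))

theorem _root_.Irreducible.exists_rootsOnLine {p : ℝ[X]} (hp : Irreducible p) :
    ∃ a, RootsOnLine p a := by
  obtain ⟨z, hz⟩ := IsAlgClosed.exists_aeval_eq_zero ℂ p hp.degree_pos.ne'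
  refine ⟨z.re, fun w hw => ?_⟩
  obtain ⟨b, hb⟩ : ∃ b : ℝ, (b : ℂ) = z + starRingEnd ℂ z := ⟨_, (Complex.add_conj z).symm⟩
  obtain ⟨c, hc⟩ : ∃ c : ℝ, (c : ℂ) = z * starRingEnd ℂ z := ⟨_, (Complex.mul_conj z).symm⟩
  let q : ℝ[X] := X ^ 2 - C b * X + C c
  have hq : ∀ w : ℂ, aeval w q = (w - z) * (w - starRingEnd ℂ z) := by
    intro w
    simp only [q, map_add, map_sub, map_mul, map_pow, aeval_X, aeval_C, Complex.coe_algebraMap]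
    rw [hb, hc]; ring
  -- An irreducible `p` divides every real polynomial sharing its root `z`, in particular `(X - z)(X
  -- - conj z)`; so its roots are among `z` and its conjugate.
  have hdvd : p ∣ q := by
    rw [← hp.dvd_iff_aeval_eq_zero (b := z) hz, hq, sub_self, zero_mul]
  obtain ⟨r, hr⟩ := hdvd
  have : aeval w q = 0 := by rw [hr, map_mul, hw, zero_mul]
  rw [hq, mul_eq_zero, sub_eq_zero, sub_eq_zero] at this
  rcases this with rfl | rfl <;> simp

/-- Every nonzero real polynomial divides a product of polynomials grouping its roots by their
real parts. -/
theorem exists_dvd_prod_rootsOnLine {m : ℝ[X]} (hm : m ≠ 0) :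
    ∃ (s : Finset ℝ) (p : ℝ → ℝ[X]), (∀ a, RootsOnLine (p a) a) ∧ m ∣ ∏ a ∈ s, p a := by
  induction m using WfDvdMonoid.induction_on_irreducible with
  | zero => exact absurd rfl hm
  | unit u hu => exact ⟨∅, fun _ => 1, rootsOnLine_one, hu.dvd⟩
  | mul m i hm0 hi ih =>
    obtain ⟨s, p, hp, hdvd⟩ := ih hm0
    obtain ⟨b, hb⟩ := hi.exists_rootsOnLine
    classical
    refine ⟨insert b s, fun a => (if a = b then i else 1) * (if a ∈ s then p a else 1),
      fun a => ?_, ?_⟩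
    · refine RootsOnLine.mul ?_ ?_
      · split_ifs with h
        · exact h ▸ hb
        · exact rootsOnLine_one a
      · split_ifs
        · exact hp a
        · exact rootsOnLine_one a
    · rw [Finset.prod_mul_distrib]
      refine mul_dvd_mul ?_ ?_
      · simp
      · refine hdvd.trans ?_
        rw [Finset.prod_ite_mem, Finset.inter_eq_right.2 (Finset.subset_insert b s)]

theorem hasImaginarySpectrum_of_aeval_eq_zero {W : Type*} [AddCommGroup W] [Module ℝ W]
    {σ : Module.End ℝ W} {p : ℝ[X]} (hp : RootsOnLine p 0) (hσ : aeval σ p = 0) :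
    HasImaginarySpectrum σ := by
  intro z hz
  apply hp
  obtain ⟨v, hv⟩ := hz.exists_hasEigenvector
  have h1 : aeval (LinearMap.baseChange ℂ σ) (p.map (algebraMap ℝ ℂ)) = 0 := by
    rw [aeval_map_algebraMap]
    have := Polynomial.aeval_algHom_apply (Module.End.baseChangeHom ℝ ℂ W) σ p
    rw [hσ, map_zero] at this
    exact this
  have h2 := Module.End.aeval_apply_of_hasEigenvector (p := p.map (algebraMap ℝ ℂ)) hv
  rw [h1, LinearMap.zero_apply, eval_map_algebraMap] at h2
  exact (smul_eq_zero.1 h2.symm).resolve_right hv.2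

variable {V : Type*} [AddCommGroup V] [Module ℝ V]

/-- A decomposition of `V` into invariant subspaces, on each of which the spectrum of `A` lies on
a vertical line. -/
structure LyapunovDecomposition (A : Module.End ℝ V) where
  /-- The real parts of the eigenvalues. -/
  exponents : Finset ℝ
  /-- A polynomial annihilating the summand of a given exponent. -/
  poly : ℝ → ℝ[X]
  /-- The projection to the summand of a given exponent. -/
  proj : ℝ → Module.End ℝ V
  rootsOnLine : ∀ a, RootsOnLine (poly a) a
  commute_proj : ∀ a, Commute A (proj a)
  sum_proj : ∑ a ∈ exponents, proj a = 1
  aeval_proj : ∀ a ∈ exponents, ∀ x, aeval A (poly a) (proj a x) = 0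
  proj_of_mem : ∀ a ∈ exponents, ∀ x, aeval A (poly a) x = 0 → proj a x = x
  proj_of_ne : ∀ a ∈ exponents, ∀ b ∈ exponents, a ≠ b → ∀ x, aeval A (poly a) x = 0 → proj b x = 0
  exists_ne_zero : ∀ a ∈ exponents, ∃ x ≠ 0, aeval A (poly a) x = 0

theorem nonempty_lyapunovDecomposition [FiniteDimensional ℝ V] (A : Module.End ℝ V) :
    Nonempty (LyapunovDecomposition A) := by
  classical
  obtain ⟨s, p, hp, hdvd⟩ := exists_dvd_prod_rootsOnLine
    (minpoly.ne_zero (Algebra.IsIntegral.isIntegral (R := ℝ) A))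
  have hprod : aeval A (∏ a ∈ s, p a) = 0 := by
    obtain ⟨r, hr⟩ := hdvd
    rw [hr, map_mul, minpoly.aeval, zero_mul]
  -- Bézout for the pairwise coprime `p a`; the summands, evaluated at `A`, are the projections. If
  -- `s` is empty, `hprod` says `1 = 0`.
  obtain ⟨u, hu⟩ : ∃ u : ℝ → ℝ[X],
      ∑ a ∈ s, aeval A (u a * ∏ b ∈ s \ {a}, p b) = 1 := by
    rcases s.eq_empty_or_nonempty with rfl | hs
    · refine ⟨0, ?_⟩
      simpa using hprod.symm
    · obtain ⟨u, hu⟩ := (exists_sum_eq_one_iff_pairwise_coprime hs (s := p)).2 fun a b hab =>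
        (hp a).isCoprime (hp b) fun h => hab (Subtype.ext h)
      exact ⟨u, by rw [← map_sum, hu, map_one]⟩
  let P : ℝ → Module.End ℝ V := fun a => aeval A (u a * ∏ b ∈ s \ {a}, p b)
  have hP : ∀ a ∈ s, ∀ x, aeval A (p a) (P a x) = 0 := by
    intro a ha x
    rw [← Module.End.mul_apply, ← map_mul, mul_left_comm,
      ← Finset.prod_eq_mul_prod_sdiff_singleton_of_mem ha, map_mul, hprod, mul_zero, LinearMap.zero_apply]
  have hne : ∀ a ∈ s, ∀ b, a ≠ b → ∀ x, aeval A (p a) x = 0 → P b x = 0 := by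
    intro a ha b hab x hx
    obtain ⟨r, hr⟩ : p a ∣ u b * ∏ c ∈ s \ {b}, p c :=
      (Finset.dvd_prod_of_mem p (by simp [ha, hab])).mul_left _
    simp only [P]
    rw [hr, mul_comm, map_mul, Module.End.mul_apply, hx, map_zero]
  -- Zero summands are discarded, so that every exponent gives a nonempty projective subspace; their
  -- projections vanish, so the sum is unchanged.
  let t := s.filter fun a => ∃ x ≠ 0, aeval A (p a) x = 0
  have ht : t ⊆ s := Finset.filter_subset _ _
  have hmem : ∀ a ∈ s, ∀ x, aeval A (p a) x = 0 → P a x = x := by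
    intro a ha x hx
    have h := congrArg (fun f : Module.End ℝ V => f x) hu
    simp only [LinearMap.sum_apply, Module.End.one_apply] at h
    rwa [Finset.sum_eq_single_of_mem a ha fun b _ hb => hne a ha b hb.symm x hx] at h
  refine ⟨⟨t, p, P, hp, fun a => ?_, ?_, fun a ha => hP a (ht ha), fun a ha => hmem a (ht ha),
    fun a ha b _ => hne a (ht ha) b, fun a ha => (Finset.mem_filter.1 ha).2⟩⟩
  · simpa only [aeval_X] using (Commute.all (X : ℝ[X]) (u a * ∏ b ∈ s \ {a}, p b)).map (aeval A)
  · rw [← hu]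
    refine Finset.sum_subset ht fun a ha hat => LinearMap.ext fun x => ?_
    by_contra hx
    exact hat (Finset.mem_filter.2 ⟨ha, P a x, hx, hP a ha x⟩)

end ProjFlow

namespace ProjFlow

open Polynomial Filter Topology

/-! ### Asymptotics of a complex linear flow -/

section Complex

variable {E : Type*} [NormedAddCommGroup E] [NormedSpace ℂ E] [FiniteDimensional ℂ E]

theorem hasSum_exp_smul_apply (T : E →L[ℂ] E) (z : ℂ) (y : E) :
    HasSum (fun n : ℕ => (z ^ n / (n.factorial : ℂ)) • (T ^ n) y) (NormedSpace.exp (z • T) y) := by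
  have : CompleteSpace E := FiniteDimensional.complete ℂ E
  have h := (NormedSpace.exp_series_hasSum_exp' (𝕂 := ℂ) (z • T)).map
    (ContinuousLinearMap.apply ℂ E y) (ContinuousLinearMap.apply ℂ E y).continuous
  convert! h using 2 with n
  simp [_root_.smul_pow, div_eq_inv_mul, mul_smul]

/-- Factor out `exp (t z)`; the exponential series of `t (T - z)` terminates on a generalized
eigenvector. -/
theorem exp_smul_apply_of_pow_apply_eq_zero {T : E →L[ℂ] E} {z : ℂ} {y : E} {k : ℕ}
    (h : ((T - z • 1) ^ k) y = 0) (t : ℂ) :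
    NormedSpace.exp (t • T) y = Complex.exp (t * z) •
      ∑ j ∈ Finset.range k, (t ^ j / (j.factorial : ℂ)) • ((T - z • 1) ^ j) y := by
  have : CompleteSpace E := FiniteDimensional.complete ℂ E
  let _ : NormedAlgebra ℚ (E →L[ℂ] E) := NormedAlgebra.restrictScalars ℚ ℂ _
  have h1 : t • T = (t * z) • 1 + t • (T - z • 1) := by
    rw [smul_sub, smul_smul]; abel
  have h2 : NormedSpace.exp ((t * z) • (1 : E →L[ℂ] E)) = Complex.exp (t * z) • 1 := by
    rw [← Algebra.algebraMap_eq_smul_one, ← NormedSpace.algebraMap_exp_comm,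
      Algebra.algebraMap_eq_smul_one, Complex.exp_eq_exp_ℂ]
  rw [h1, NormedSpace.exp_add_of_commute ((Commute.one_left _).smul_left _), h2]
  simp only [smul_mul_assoc, one_mul, smul_apply]
  congr 1
  refine (hasSum_exp_smul_apply (T - z • 1) t y).unique (hasSum_sum_of_ne_finset_zero ?_)
  intro j hj
  obtain ⟨i, rfl⟩ := Nat.exists_eq_add_of_le (not_lt.1 (Finset.mem_range.not.1 hj))
  rw [add_comm k, pow_add (T - z • 1), mul_apply_eq_comp, h, map_zero, smul_zero]

/-- By independence of the generalized eigenspaces, `q(T)` kills each component of `y`. If `q z ≠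
0`, then `q` is coprime to the power of `X - z` that also kills the component, which is therefore
zero. -/
theorem exists_generalizedEigenvector_sum {T : E →L[ℂ] E} {q : ℂ[X]} {y : E}
    (h : aeval (T : Module.End ℂ E) q y = 0) :
    ∃ (s : Finset ℂ) (c : ℂ → E), (∀ z ∈ s, q.eval z = 0) ∧
      (∀ z ∈ s, ((T - z • 1) ^ Module.finrank ℂ E) (c z) = 0) ∧ ∑ z ∈ s, c z = y := by
  have hy : y ∈ ⨆ z, Module.End.maxGenEigenspace (T : Module.End ℂ E) z := by
    rw [Module.End.iSup_maxGenEigenspace_eq_top]; trivial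
  obtain ⟨c, hc, hsum⟩ := (Submodule.mem_iSup_iff_exists_finsupp _ _).1 hy
  have hpow : ∀ z : ℂ, ((T - z • 1) ^ Module.finrank ℂ E) (c z) = 0 := by
    intro z
    have := hc z
    rw [Module.End.maxGenEigenspace_eq_genEigenspace_finrank,
      Module.End.mem_genEigenspace_nat] at this
    rw [← ContinuousLinearMap.coe_coe, ContinuousLinearMap.toLinearMap_pow]
    exact this
  have hind := (iSupIndep_iff_finsetSum_eq_zero_imp_eq_zero _).1
    (Module.End.independent_maxGenEigenspace (T : Module.End ℂ E)) c.support
    (fun z => aeval (T : Module.End ℂ E) q (c z)) (fun z _ =>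
      Module.End.mapsTo_maxGenEigenspace_of_comm (by
        simpa only [aeval_X] using (Commute.all X q).map (aeval (T : Module.End ℂ E))) z (hc z)) (by
      rw [← map_sum]
      exact (congrArg _ hsum).trans h)
  refine ⟨c.support, c, fun z hz => ?_, fun z _ => hpow z, hsum⟩
  by_contra hq
  obtain ⟨u, v, huv⟩ : IsCoprime ((X - C z) ^ Module.finrank ℂ E) q := by
    refine IsCoprime.pow_left ((irreducible_X_sub_C z).coprime_iff_not_dvd.2 ?_)
    rwa [dvd_iff_isRoot]
  have h1 := congrArg (fun r => aeval (T : Module.End ℂ E) r (c z)) huv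
  simp only [map_add, map_mul, LinearMap.add_apply, Module.End.mul_apply, hind z hz, map_zero,
    add_zero, map_one, Module.End.one_apply, map_pow, map_sub, aeval_X, aeval_C] at h1
  refine Finsupp.mem_support_iff.1 hz (h1.symm.trans ?_)
  have h2 := hpow z
  rw [← ContinuousLinearMap.coe_coe, ContinuousLinearMap.toLinearMap_pow] at h2
  rw [Algebra.algebraMap_eq_smul_one]
  exact (congrArg _ h2).trans (map_zero _)

theorem tendsto_smul_sum_pow {F : Type*} [NormedAddCommGroup F] [NormedSpace ℝ F]
    {r : ℕ} {w : ℕ → ℝ → F} (hw : ∀ j, ∃ C, ∀ t, ‖w j t‖ ≤ C) :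
    Tendsto (fun t : ℝ => (t ^ r)⁻¹ • (∑ j ∈ Finset.range (r + 1), t ^ j • w j t) - w r t)
      (Bornology.cobounded ℝ) (𝓝 0) := by
  have hmain : Tendsto (fun t : ℝ => ∑ j ∈ Finset.range r, t⁻¹ ^ (r - j) • w j t)
      (Bornology.cobounded ℝ) (𝓝 0) := by
    rw [← Finset.sum_const_zero (s := Finset.range r)]
    refine tendsto_finsetSum _ fun j hj => ?_
    have hj' : r - j ≠ 0 := (Nat.sub_pos_of_lt (Finset.mem_range.1 hj)).ne'
    obtain ⟨C, hC⟩ := hw j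
    refine Tendsto.zero_smul_isBoundedUnder_le ?_ ⟨C, eventually_map.2 (.of_forall hC)⟩
    simpa [hj'] using (tendsto_inv₀_cobounded (α := ℝ)).pow (r - j)
  refine hmain.congr' ?_
  filter_upwards [Bornology.eventually_ne_cobounded (0 : ℝ)] with t ht
  rw [Finset.sum_range_succ, smul_add, smul_smul, inv_mul_cancel₀ (pow_ne_zero r ht), one_smul,
    add_sub_cancel_right, Finset.smul_sum]
  refine Finset.sum_congr rfl fun j hj => ?_
  rw [smul_smul, inv_pow, pow_sub₀ t ht (Finset.mem_range.1 hj).le, mul_inv, inv_inv]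

/-- Asymptotics of a trajectory of the linear flow of `T` in a sum of generalized eigenspaces with
the same real part. -/
theorem exists_exp_asymptotics {T : E →L[ℂ] E} {q : ℂ[X]} {a : ℝ}
    (hq : ∀ z : ℂ, q.eval z = 0 → z.re = a) {y : E} (h : aeval (T : Module.End ℂ E) q y = 0)
    (hy : y ≠ 0) :
    ∃ (s : Finset ℂ) (Φ : (s → Circle) → E) (r : ℕ), Continuous Φ ∧ (∀ u, Φ u ≠ 0) ∧
      Tendsto (fun t : ℝ => ((Real.exp (a * t))⁻¹ * (t ^ r)⁻¹) • NormedSpace.exp ((t : ℂ) • T) y -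
        Φ (fun z => Circle.exp (z.1.im * t))) (Bornology.cobounded ℝ) (𝓝 0) := by
  obtain ⟨s, c, hs, hc, hsum⟩ := exists_generalizedEigenvector_sum h
  let v : ℂ → ℕ → E := fun z j => ((T - z • 1) ^ j) (c z)
  have hv : ∀ z i j, v z (i + j) = ((T - z • 1) ^ i) (v z j) := fun z i j => by
    simp only [v, pow_add, mul_apply_eq_comp]
  have hex : ∃ n, ∀ z ∈ s, v z n = 0 := ⟨_, hc⟩
  classical
  -- `r` is the highest power of `t` that survives in any of the components.
  obtain ⟨r, hr⟩ : ∃ r, Nat.find hex = r + 1 := by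
    refine Nat.exists_eq_succ_of_ne_zero fun h0 => hy ?_
    rw [← hsum]
    exact Finset.sum_eq_zero fun z hz => ((Nat.find_eq_zero hex).1 h0) z hz
  have hr1 : ∀ z ∈ s, v z (r + 1) = 0 := hr ▸ Nat.find_spec hex
  have hr2 : ∃ z ∈ s, v z r ≠ 0 := by
    have := Nat.find_min hex (m := r) (by omega)
    simpa using this
  let w : ℕ → (s → Circle) → E := fun j u => ((j.factorial : ℂ)⁻¹) • ∑ z, (u z : ℂ) • v z.1 j
  have hw : ∀ j, Continuous (w j) := fun j => by fun_prop
  refine ⟨s, w r, r, hw r, fun u hu => ?_, ?_⟩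
  · rw [smul_eq_zero_iff_right (inv_ne_zero (by exact_mod_cast r.factorial_ne_zero))] at hu
    obtain ⟨z, hz, hzr⟩ := hr2
    -- The nonzero `v z r` are eigenvectors for distinct eigenvalues, so no combination with
    -- unimodular coefficients vanishes.
    have := (iSupIndep_iff_finsetSum_eq_zero_imp_eq_zero _).1
      ((Module.End.independent_maxGenEigenspace (T : Module.End ℂ E)).comp
        (Subtype.val_injective (p := (· ∈ s)))) Finset.univ
      (fun z => (u z : ℂ) • v z.1 r) (fun z _ => by
        refine Submodule.smul_mem _ _ ((Module.End.mem_maxGenEigenspace _ _ _).2 ⟨1, ?_⟩)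
        have h1 := hr1 z.1 z.2
        rw [add_comm, hv] at h1
        rw [pow_one] at h1 ⊢
        exact h1) hu ⟨z, hz⟩ (Finset.mem_univ _)
    exact hzr ((smul_eq_zero.1 this).resolve_left (Circle.coe_ne_zero _))
  · have hb : ∀ j, ∃ C, ∀ t : ℝ, ‖w j (fun z => Circle.exp (z.1.im * t))‖ ≤ C := by
      intro j
      obtain ⟨C, hC⟩ := isCompact_univ.exists_bound_of_continuousOn (hw j).continuousOn
      exact ⟨C, fun t => hC _ trivial⟩
    refine (tendsto_smul_sum_pow (r := r) hb).congr fun t => ?_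
    congr 1
    rw [mul_comm, mul_smul]
    congr 1
    rw [← hsum, map_sum, ← Finset.sum_coe_sort s, Finset.smul_sum]
    simp only [w, Finset.smul_sum]
    rw [Finset.sum_comm]
    refine Finset.sum_congr rfl fun z _ => ?_
    rw [exp_smul_apply_of_pow_apply_eq_zero (hr1 z z.2), Finset.smul_sum, Finset.smul_sum]
    refine Finset.sum_congr rfl fun j _ => ?_
    have hz : (t : ℂ) * z = (a * t : ℝ) + (z.1.im * t : ℝ) * Complex.I := by
      apply Complex.ext <;> simp [hq _ (hs z z.2), mul_comm]
    rw [hz, Complex.exp_add, ← Complex.ofReal_exp, Circle.coe_exp]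
    simp only [← Complex.coe_smul (E := E), smul_smul]
    congr 1
    have : ((Real.exp (a * t) : ℝ) : ℂ) ≠ 0 := by exact_mod_cast (Real.exp_pos _).ne'
    push_cast
    field_simp

end Complex

end ProjFlow

/-! ### Growth and return times of real trajectories -/

namespace ProjFlow

open Polynomial Filter Topology

/-- The torus is compact, so the phases at some integer times `φ n` converge; between `φ n` and `φ
(2 * n)` they change by a factor tending to `1`. -/
theorem exists_tendsto_circle_exp_one (s : Finset ℂ) :
    ∃ τ : ℕ → ℝ, Tendsto τ atTop atTop ∧
      Tendsto (fun n => fun z : s => Circle.exp (z.1.im * τ n)) atTop (𝓝 1) := by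
  let θ : ℝ → s → Circle := fun t z => Circle.exp (z.1.im * t)
  obtain ⟨b, φ, hφ, hb⟩ := CompactSpace.tendsto_subseq (fun n : ℕ => θ n)
  refine ⟨fun n => (φ (2 * n) : ℝ) - φ n, ?_, ?_⟩
  · refine tendsto_atTop_mono (fun n => ?_) tendsto_natCast_atTop_atTop
    have h : φ n + n ≤ φ (n + n) := by
      have : ∀ k, φ n + k ≤ φ (n + k) := by
        intro k
        induction k with
        | zero => simp
        | succ k ih => exact Nat.succ_le_of_lt (ih.trans_lt (hφ (Nat.lt_succ_self _)))
      exact this n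
    rw [two_mul, le_sub_iff_add_le']
    exact_mod_cast h
  · have h2 : Tendsto (fun n : ℕ => 2 * n) atTop atTop :=
      tendsto_id.const_mul_atTop' two_pos
    have := (hb.comp h2).div' hb
    rw [div_self'] at this
    refine this.congr fun n => funext fun z => ?_
    simp [θ, mul_sub, Circle.exp_sub]

/-- The normalization of a trajectory of exponential growth rate `a` and polynomial order `r`. -/
def growthScale (a : ℝ) (r : ℕ) (t : ℝ) : ℝ := (Real.exp (a * t))⁻¹ * (t ^ r)⁻¹

theorem growthScale_ne_zero (a : ℝ) (r : ℕ) {t : ℝ} (ht : t ≠ 0) : growthScale a r t ≠ 0 :=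
  mul_ne_zero (inv_ne_zero (Real.exp_ne_zero _)) (inv_ne_zero (pow_ne_zero r ht))

variable {V : Type*} [NormedAddCommGroup V] [NormedSpace ℝ V]

theorem map_aeval_apply {E : Type*} [NormedAddCommGroup E] [NormedSpace ℂ E]
    {A : Module.End ℝ V} {ι : V →ₗ[ℝ] E} {T : E →L[ℂ] E}
    (h : ∀ x, ι (A x) = T (ι x)) (p : ℝ[X]) (x : V) :
    ι (aeval A p x) = aeval (T : Module.End ℂ E) (p.map (algebraMap ℝ ℂ)) (ι x) := by
  induction p using Polynomial.induction_on' generalizing x with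
  | add p q hp hq => simp [hp, hq]
  | monomial n c =>
    have hpow : ∀ n : ℕ, ι ((A ^ n) x) = ((T : Module.End ℂ E) ^ n) (ι x) := by
      intro n
      induction n with
      | zero => simp
      | succ n ih => rw [pow_succ', pow_succ', Module.End.mul_apply, h, ih]; rfl
    rw [map_monomial, aeval_monomial, aeval_monomial, Module.End.mul_apply, Module.End.mul_apply,
      ← hpow]
    simp [Module.algebraMap_end_apply]

variable [FiniteDimensional ℝ V]

/-- A realization of `V` as a real form of a complex space, with the complexification of `A`. -/
theorem exists_complexification (A : Module.End ℝ V) :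
    ∃ (n : ℕ) (ι : V →ₗ[ℝ] (Fin n → ℂ)) (T : (Fin n → ℂ) →L[ℂ] (Fin n → ℂ)),
      Function.Injective ι ∧ ∀ x, ι (A x) = T (ι x) := by
  let b := Module.finBasis ℝ V
  refine ⟨_, (LinearMap.compLeft Complex.ofRealCLM.toLinearMap _).comp b.equivFun.toLinearMap,
    LinearMap.toContinuousLinearMap
      (Matrix.toLin' ((LinearMap.toMatrix b b A).map Complex.ofRealHom)), ?_, ?_⟩
  · intro x y hxy
    apply b.equivFun.injective
    ext i
    exact Complex.ofReal_injective (congrFun hxy i)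
  · intro x
    ext i
    have h1 := congrFun (LinearMap.toMatrix_mulVec_repr b b A x) i
    have h2 := RingHom.map_mulVec Complex.ofRealHom (LinearMap.toMatrix b b A) (b.repr x) i
    rw [h1] at h2
    exact h2

theorem map_expMap_apply {E : Type*} [NormedAddCommGroup E] [NormedSpace ℂ E]
    [FiniteDimensional ℂ E] {A : Module.End ℝ V} {ι : V →ₗ[ℝ] E} {T : E →L[ℂ] E}
    (h : ∀ x, ι (A x) = T (ι x)) (t : ℝ) (x : V) :
    ι (expMap A t x) = NormedSpace.exp ((t : ℂ) • T) (ι x) := by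
  have : CompleteSpace V := FiniteDimensional.complete ℝ V
  have h1 := ((NormedSpace.exp_series_hasSum_exp' (𝕂 := ℝ)
    (t • LinearMap.toContinuousLinearMap A)).map (ContinuousLinearMap.apply ℝ V x)
      (ContinuousLinearMap.apply ℝ V x).continuous).map ι ι.continuous_of_finiteDimensional
  refine h1.unique ?_
  convert! hasSum_exp_smul_apply T t (ι x) using 2 with n
  have hpow : ∀ n : ℕ, ι ((A ^ n) x) = (T ^ n) (ι x) := by
    intro n
    induction n with
    | zero => simp
    | succ n ih => rw [pow_succ', pow_succ', Module.End.mul_apply, h, ih, mul_apply_eq_comp]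
  have hcl : (LinearMap.toContinuousLinearMap A) ^ n = LinearMap.toContinuousLinearMap (A ^ n) := by
    ext y
    rw [← ContinuousLinearMap.coe_coe, ContinuousLinearMap.toLinearMap_pow]
    rfl
  simp only [Function.comp, _root_.smul_pow, hcl, smul_smul, ContinuousLinearMap.apply_apply,
    LinearMap.coe_toContinuousLinearMap', map_smul, hpow]
  rw [← Complex.coe_smul]
  congr 1
  push_cast
  rw [div_eq_inv_mul]

/-- The bounds come from compactness of the torus, on which the limit function `Φ` has no zero. If
the phases at `τ n` tend to `1`, so do their inverses, the phases at `-τ n`; hence the same limit `Φ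
1` in both directions of time. -/
theorem exists_flow_asymptotics {A : Module.End ℝ V} {p : ℝ[X]} {a : ℝ} (hp : RootsOnLine p a)
    {x : V} (hx : aeval A p x = 0) (hx0 : x ≠ 0) :
    ∃ (r : ℕ) (m M : ℝ), 0 < m ∧
      (∀ᶠ t in Bornology.cobounded ℝ, m ≤ ‖growthScale a r t • expMap A t x‖ ∧
        ‖growthScale a r t • expMap A t x‖ ≤ M) ∧
      ∃ v ≠ 0, ∃ τ : ℕ → ℝ, Tendsto τ atTop atTop ∧
        Tendsto (fun n => growthScale a r (τ n) • expMap A (τ n) x) atTop (𝓝 v) ∧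
        Tendsto (fun n => growthScale a r (-τ n) • expMap A (-τ n) x) atTop (𝓝 v) := by
  obtain ⟨n, ι, T, hι, hT⟩ := exists_complexification A
  have hemb := LinearMap.isClosedEmbedding_of_injective (LinearMap.ker_eq_bot.2 hι)
  have hy : aeval (T : Module.End ℂ (Fin n → ℂ)) (p.map (algebraMap ℝ ℂ)) (ι x) = 0 := by
    rw [← map_aeval_apply hT, hx, map_zero]
  obtain ⟨s, Φ, r, hΦ, hΦ0, hlim⟩ := exists_exp_asymptotics (a := a)
    (fun z hz => hp z (by rwa [eval_map_algebraMap] at hz)) hy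
    (fun h => hx0 (hι (h.trans (map_zero ι).symm)))
  have hcurve : ∀ t : ℝ, ((Real.exp (a * t))⁻¹ * (t ^ r)⁻¹) • NormedSpace.exp ((t : ℂ) • T) (ι x) =
      ι (growthScale a r t • expMap A t x) := by
    intro t
    rw [map_smul, map_expMap_apply hT, growthScale]
  simp only [hcurve] at hlim
  set f : ℝ → V := fun t => growthScale a r t • expMap A t x
  let θ : ℝ → s → Circle := fun t z => Circle.exp (z.1.im * t)
  obtain ⟨M, hM⟩ := isCompact_univ.exists_bound_of_continuousOn hΦ.continuousOn
  obtain ⟨u₀, -, hu₀⟩ := isCompact_univ.exists_isMinOn Set.univ_nonempty hΦ.norm.continuousOn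
  have hm : 0 < ‖Φ u₀‖ := norm_pos_iff.2 (hΦ0 u₀)
  obtain ⟨K, hK0, hK⟩ := LinearMap.exists_antilipschitzWith ι (LinearMap.ker_eq_bot.2 hι)
  let ιc : V →L[ℝ] (Fin n → ℂ) := LinearMap.toContinuousLinearMap ι
  have hc0 : 0 < ‖ιc‖ + 1 := by positivity
  refine ⟨r, ‖Φ u₀‖ / 2 / (‖ιc‖ + 1), K * (M + 1), by positivity, ?_, ?_⟩
  · have h1 : ∀ᶠ t in Bornology.cobounded ℝ,
        ‖ι (f t) - Φ (θ t)‖ < min (‖Φ u₀‖ / 2) 1 := by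
      have := hlim.norm
      rw [norm_zero] at this
      exact this.eventually (gt_mem_nhds (by positivity))
    filter_upwards [h1] with t ht
    have h2 : ‖Φ u₀‖ ≤ ‖Φ (θ t)‖ := hu₀ (Set.mem_univ _)
    have h3 := hM (θ t) trivial
    have h4 := norm_sub_norm_le (Φ (θ t)) (ι (f t))
    have h5 := norm_sub_norm_le (ι (f t)) (Φ (θ t))
    rw [norm_sub_rev] at h4
    have h6 := min_le_left (‖Φ u₀‖ / 2) 1
    have h7 := min_le_right (‖Φ u₀‖ / 2) 1
    constructor
    · rw [div_le_iff₀ hc0]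
      have h8 : ‖ι (f t)‖ ≤ ‖ιc‖ * ‖f t‖ := ιc.le_opNorm (f t)
      nlinarith [norm_nonneg (f t)]
    · have h8 := hK.le_mul_dist (f t) 0
      rw [map_zero, dist_zero_right, dist_zero_right] at h8
      refine h8.trans ?_
      gcongr
      linarith
  · obtain ⟨τ, hτ, hτ1⟩ := exists_tendsto_circle_exp_one s
    have hcob : Tendsto τ atTop (Bornology.cobounded ℝ) :=
      hτ.mono_right (IsOrderBornology.atTop_le_cobounded)
    have hcob' : Tendsto (fun n => -τ n) atTop (Bornology.cobounded ℝ) :=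
      (tendsto_neg_atTop_atBot.comp hτ).mono_right (IsOrderBornology.atBot_le_cobounded)
    have hτ2 : Tendsto (fun n => θ (-τ n)) atTop (𝓝 1) := by
      have := hτ1.inv
      rw [inv_one] at this
      refine this.congr fun n => funext fun z => ?_
      simp [θ]
    have h1 : Tendsto (fun n => ι (f (τ n))) atTop (𝓝 (Φ 1)) := by
      have := (hlim.comp hcob).add ((hΦ.tendsto 1).comp hτ1)
      rw [zero_add] at this
      exact this.congr fun n => sub_add_cancel _ _
    have h2 : Tendsto (fun n => ι (f (-τ n))) atTop (𝓝 (Φ 1)) := by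
      have := (hlim.comp hcob').add ((hΦ.tendsto 1).comp hτ2)
      rw [zero_add] at this
      exact this.congr fun n => sub_add_cancel _ _
    -- The real form is closed in the complex space, so the limit is again a real vector.
    obtain ⟨v, hv⟩ := hemb.isClosed_range.mem_of_tendsto h1 (.of_forall fun n => ⟨_, rfl⟩)
    rw [← hv] at h1 h2
    refine ⟨v, ?_, τ, hτ, hemb.isInducing.tendsto_nhds_iff.2 h1,
      hemb.isInducing.tendsto_nhds_iff.2 h2⟩
    rintro rfl
    exact hΦ0 1 (by rw [← hv, map_zero])

theorem tendsto_growthScale_div_atTop {a b : ℝ} (hab : b < a) (r s : ℕ) :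
    Tendsto (fun t => ‖growthScale a r t / growthScale b s t‖) atTop (𝓝 0) := by
  have h1 := tendsto_rpow_mul_exp_neg_mul_atTop_nhds_zero ((s : ℝ) - r) (a - b) (sub_pos.2 hab)
  refine h1.congr' ?_
  filter_upwards [eventually_gt_atTop 0] with t ht
  rw [Real.norm_of_nonneg (by unfold growthScale; positivity), growthScale, growthScale,
    Real.rpow_sub ht, Real.rpow_natCast, Real.rpow_natCast, neg_sub, sub_mul, Real.exp_sub]
  field_simp

theorem tendsto_growthScale_div_atBot {a b : ℝ} (hab : a < b) (r s : ℕ) :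
    Tendsto (fun t => ‖growthScale a r t / growthScale b s t‖) atBot (𝓝 0) := by
  have h1 := (tendsto_growthScale_div_atTop (neg_lt_neg hab) r s).comp tendsto_neg_atBot_atTop
  refine h1.congr fun t => ?_
  simp [growthScale, norm_mul, norm_div]

/-- The filter `l` allows both time directions: at `atTop` the larger exponent dominates, at `atBot`
the smaller. -/
theorem tendsto_norm_expMap_div {A : Module.End ℝ V} {p q : ℝ[X]} {a b : ℝ}
    (hp : RootsOnLine p a) (hq : RootsOnLine q b) {l : Filter ℝ} (hl : l ≤ Bornology.cobounded ℝ)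
    (hscale : ∀ r s, Tendsto (fun t => ‖growthScale a r t / growthScale b s t‖) l (𝓝 0)) {x y : V}
    (hx : aeval A p x = 0) (hx0 : x ≠ 0) (hy : aeval A q y = 0) :
    Tendsto (fun t => ‖expMap A t y‖ / ‖expMap A t x‖) l (𝓝 0) := by
  rcases eq_or_ne y 0 with rfl | hy0
  · simpa using tendsto_const_nhds
  obtain ⟨r, m, M₁, hm, hxt, -⟩ := exists_flow_asymptotics hp hx hx0
  obtain ⟨s, m₁, M, -, hyt, -⟩ := exists_flow_asymptotics hq hy hy0
  have h1 := (hscale r s).const_mul (M / m)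
  rw [mul_zero] at h1
  refine squeeze_zero' (.of_forall fun t => by positivity) ?_ h1
  filter_upwards [hl hxt, hl hyt, hl (Bornology.eventually_ne_cobounded (0 : ℝ))] with t htx hty ht
  have ha := norm_pos_iff.2 (growthScale_ne_zero a r ht)
  have hb := norm_pos_iff.2 (growthScale_ne_zero b s ht)
  rw [norm_smul] at htx hty
  have hxp : 0 < ‖expMap A t x‖ := by
    by_contra h
    have : ‖expMap A t x‖ = 0 := le_antisymm (not_lt.1 h) (norm_nonneg _)
    rw [this, mul_zero] at htx
    linarith [htx.1]
  rw [norm_div, div_mul_div_comm, div_le_div_iff₀ hxp (by positivity)]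
  calc ‖expMap A t y‖ * (m * ‖growthScale b s t‖)
      = (‖growthScale b s t‖ * ‖expMap A t y‖) * m := by ring
    _ ≤ M * (‖growthScale a r t‖ * ‖expMap A t x‖) :=
        mul_le_mul hty.2 htx.1 hm.le ((norm_nonneg _).trans ((norm_smul _ _).le.trans hty.2))
    _ = M * ‖growthScale a r t‖ * ‖expMap A t x‖ := by ring

end ProjFlow

namespace ProjFlow

open Polynomial Filter Topology Set

/-! ### Topology of projective subspaces -/

section Projective

variable {V : Type*} [NormedAddCommGroup V] [NormedSpace ℝ V]

theorem tendsto_mk_of_tendsto_smul {ι : Type*} {l : Filter ι} {f : ι → V} {c : ι → ℝ} {v : V}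
    (hf : ∀ i, f i ≠ 0) (hc : ∀ᶠ i in l, c i ≠ 0) (hv : v ≠ 0)
    (h : Tendsto (fun i => c i • f i) l (𝓝 v)) :
    Tendsto (fun i => Projectivization.mk ℝ (f i) (hf i)) l (𝓝 (Projectivization.mk ℝ v hv)) := by
  classical
  let u : ι → {v : V // v ≠ 0} := fun i => if hi : c i = 0 then ⟨f i, hf i⟩ else
    ⟨c i • f i, smul_ne_zero hi (hf i)⟩
  have hu : Tendsto u l (𝓝 ⟨v, hv⟩) := by
    rw [tendsto_subtype_rng]
    refine h.congr' ?_
    filter_upwards [hc] with i hi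
    simp [u, hi]
  refine ((isOpenQuotientMap_mk' (V := V)).continuous.tendsto _ |>.comp hu).congr fun i => ?_
  simp only [Function.comp, u]
  split_ifs with hi
  · rfl
  · exact (Projectivization.mk_eq_mk_iff' ℝ _ _ _ _).2 ⟨c i, rfl⟩

/-- The ratio does not depend on the representative. Its zeros are the lines in the kernel of `g`,
which makes it a continuous test for membership. -/
theorem continuous_lift_norm_div {W : Type*} [NormedAddCommGroup W] [NormedSpace ℝ W]
    (g : V →L[ℝ] W) : Continuous fun p : ℙ ℝ V => ‖g p.rep‖ / ‖p.rep‖ := by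
  rw [(isOpenQuotientMap_mk' (V := V)).isQuotientMap.continuous_iff]
  have : (fun p : ℙ ℝ V => ‖g p.rep‖ / ‖p.rep‖) ∘ Projectivization.mk' ℝ =
      fun v : {v : V // v ≠ 0} => ‖g v‖ / ‖(v : V)‖ := by
    funext v
    obtain ⟨a, ha⟩ := Projectivization.exists_smul_eq_mk_rep ℝ (v : V) v.2
    have ha' : (a : ℝ) • (v : V) = (Projectivization.mk' ℝ v).rep := ha
    simp only [Function.comp, ← ha', map_smul, norm_smul]
    exact mul_div_mul_left _ _ (norm_ne_zero_iff.2 a.ne_zero)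
  rw [this]
  refine Continuous.div ?_ ?_ fun v => norm_ne_zero_iff.2 v.2
  · exact (g.continuous.comp continuous_subtype_val).norm
  · exact continuous_subtype_val.norm

/-- The projective subspace of the lines contained in `L`. -/
def linearSet (L : Submodule ℝ V) : Set (ℙ ℝ V) := {p | p.rep ∈ L}

theorem mk_mem_linearSet {L : Submodule ℝ V} {v : V} (hv : v ≠ 0) :
    Projectivization.mk ℝ v hv ∈ linearSet L ↔ v ∈ L := by
  obtain ⟨a, ha⟩ := Projectivization.exists_smul_eq_mk_rep ℝ v hv
  rw [linearSet, mem_ofPred_eq, ← ha]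
  exact L.smul_mem_iff_of_isUnit a.isUnit

/-- The segment between representatives of two different lines of `L` stays in `L` and avoids the
origin. -/
theorem isPreconnected_linearSet (L : Submodule ℝ V) : IsPreconnected (linearSet L) := by
  refine isPreconnected_of_forall_pair fun p hp q hq => ?_
  induction p using Projectivization.ind with | h x hx =>
  induction q using Projectivization.ind with | h y hy =>
  by_cases hxy : Projectivization.mk ℝ x hx = Projectivization.mk ℝ y hy
  · exact ⟨{Projectivization.mk ℝ x hx}, by simpa using hp, rfl, hxy.symm,
      isPreconnected_singleton⟩
  rw [mk_mem_linearSet] at hp hq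
  have h0 : ∀ t : unitInterval, (1 - (t : ℝ)) • x + (t : ℝ) • y ≠ 0 := by
    intro t ht
    apply hxy
    rw [Projectivization.mk_eq_mk_iff']
    have ht1 : (1 - (t : ℝ)) ≠ 0 := by
      intro h
      have h1 : (t : ℝ) = 1 := by linarith
      rw [h, h1, zero_smul, one_smul, zero_add] at ht
      exact hy ht
    refine ⟨-((1 - (t : ℝ))⁻¹ * t), ?_⟩
    rw [add_eq_zero_iff_eq_neg] at ht
    rw [neg_smul, mul_smul, ← smul_neg, ← ht, smul_smul, inv_mul_cancel₀ ht1, one_smul]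
  let γ : unitInterval → ℙ ℝ V := fun t => Projectivization.mk' ℝ ⟨_, h0 t⟩
  have hγ : Continuous γ := (isOpenQuotientMap_mk' (V := V)).continuous.comp
    (Continuous.subtype_mk (by fun_prop) _)
  refine ⟨range γ, ?_, ⟨0, ?_⟩, ⟨1, ?_⟩, isPreconnected_range hγ⟩
  · rintro _ ⟨t, rfl⟩
    exact (mk_mem_linearSet (h0 t)).2 (L.add_mem (L.smul_mem _ hp) (L.smul_mem _ hq))
  · simp [γ, Projectivization.mk'_eq_mk]
  · simp [γ, Projectivization.mk'_eq_mk]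

variable [FiniteDimensional ℝ V]

theorem isClosed_linearSet (L : Submodule ℝ V) : IsClosed (linearSet L) := by
  obtain ⟨L', hL'⟩ := L.exists_isCompl
  let g : V →L[ℝ] V := LinearMap.toContinuousLinearMap (L'.projection L hL'.symm)
  have : linearSet L = (fun p : ℙ ℝ V => ‖g p.rep‖ / ‖p.rep‖) ⁻¹' {0} := by
    ext p
    simp [linearSet, g, p.rep_nonzero, Submodule.projection_apply_eq_zero_iff]
  rw [this]
  exact isClosed_singleton.preimage (continuous_lift_norm_div g)

instance : CompactSpace (ℙ ℝ V) := by
  refine ⟨?_⟩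
  have : CompactSpace (Metric.sphere (0 : V) 1) := isCompact_iff_compactSpace.1 (isCompact_sphere _ _)
  let f : Metric.sphere (0 : V) 1 → ℙ ℝ V := fun x => Projectivization.mk' ℝ
    ⟨x, ne_zero_of_mem_unit_sphere x⟩
  have hf : Continuous f := (isOpenQuotientMap_mk' (V := V)).continuous.comp
    (Continuous.subtype_mk continuous_subtype_val _)
  convert! isCompact_range hf
  symm
  refine eq_univ_of_forall fun p => ?_
  induction p using Projectivization.ind with | h v hv =>
  refine ⟨⟨‖v‖⁻¹ • v, by simp [norm_smul, hv]⟩, ?_⟩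
  exact (Projectivization.mk_eq_mk_iff' ℝ _ _ _ _).2 ⟨‖v‖⁻¹, rfl⟩

end Projective

end ProjFlow

namespace ProjFlow

open Polynomial Filter Topology Set

/-! ### Dimension of projective subspaces under continuous injections -/

section Dimension

variable {V W : Type*} [NormedAddCommGroup V] [NormedSpace ℝ V] [FiniteDimensional ℝ V]
  [NormedAddCommGroup W] [NormedSpace ℝ W] [FiniteDimensional ℝ W]

/-- The quotient of two linear forms, as a function on projective space. -/
def formQuotient (f g : V →ₗ[ℝ] ℝ) (p : ℙ ℝ V) : ℝ := f p.rep / g p.rep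

omit [FiniteDimensional ℝ V] in
theorem formQuotient_mk (f g : V →ₗ[ℝ] ℝ) {v : V} (hv : v ≠ 0) :
    formQuotient f g (Projectivization.mk ℝ v hv) = f v / g v := by
  obtain ⟨a, ha⟩ := Projectivization.exists_smul_eq_mk_rep ℝ v hv
  have ha' : (a : ℝ) • v = (Projectivization.mk ℝ v hv).rep := ha
  rw [formQuotient, ← ha', map_smul, map_smul]
  exact mul_div_mul_left _ _ a.ne_zero

theorem continuousAt_formQuotient (f g : V →ₗ[ℝ] ℝ) {p : ℙ ℝ V} (hp : g p.rep ≠ 0) :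
    ContinuousAt (formQuotient f g) p := by
  have h : ContinuousAt (formQuotient f g ∘ Projectivization.mk' ℝ) ⟨p.rep, p.rep_nonzero⟩ := by
    have : formQuotient f g ∘ Projectivization.mk' ℝ =
        fun v : {v : V // v ≠ 0} => f v / g v := funext fun v => formQuotient_mk f g v.2
    rw [this]
    exact ContinuousAt.div
      (f.continuous_of_finiteDimensional.comp continuous_subtype_val).continuousAt
      (g.continuous_of_finiteDimensional.comp continuous_subtype_val).continuousAt hp
  rw [isOpenQuotientMap_mk'.continuousAt_comp_iff] at h
  rwa [Projectivization.mk'_eq_mk, Projectivization.mk_rep] at h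

/-- Invariance of dimension for projective subspaces. -/
theorem finrank_le_of_injective_of_mapsTo_linearSet {h : ℙ ℝ V → ℙ ℝ W} (hc : Continuous h)
    (hinj : Function.Injective h) {L : Submodule ℝ V} {L' : Submodule ℝ W}
    (hmaps : MapsTo h (linearSet L) (linearSet L')) :
    Module.finrank ℝ L ≤ Module.finrank ℝ L' := by
  by_contra! hlt
  obtain ⟨m, hm⟩ : ∃ m, Module.finrank ℝ L = m + 1 := Nat.exists_eq_succ_of_ne_zero (by omega)
  let φ : (Fin (m + 1) → ℝ) ≃ₗ[ℝ] L := LinearEquiv.ofFinrankEq _ _ (by simp [hm])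
  -- An affine chart of `ℙ(L)`: the first homogeneous coordinate is `1`.
  let κ : EuclideanSpace ℝ (Fin m) → (Fin (m + 1) → ℝ) := fun u => Fin.cons 1 (fun i => u i)
  have hκ : ∀ u, (φ (κ u) : V) ≠ 0 := by
    intro u hu
    have h1 : κ u = 0 := φ.injective (Subtype.ext (hu.trans (by simp)))
    simpa [κ] using congrFun h1 0
  have hκc : Continuous κ := by
    refine continuous_pi fun i => ?_
    refine Fin.cases ?_ (fun i => ?_) i
    · exact continuous_const
    · exact (by fun_prop : Continuous fun u : EuclideanSpace ℝ (Fin m) => u i)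
  let γ : EuclideanSpace ℝ (Fin m) → ℙ ℝ V := fun u => Projectivization.mk' ℝ ⟨φ (κ u), hκ u⟩
  have hγ : Continuous γ := (isOpenQuotientMap_mk' (V := V)).continuous.comp
    (Continuous.subtype_mk (continuous_subtype_val.comp
      ((φ.toLinearMap.continuous_of_finiteDimensional).comp hκc)) _)
  have hγinj : Function.Injective γ := by
    intro u u' huu
    obtain ⟨a, ha⟩ := (Projectivization.mk_eq_mk_iff' ℝ _ _ _ _).1 huu
    have h1 : a • κ u' = κ u := φ.injective (Subtype.ext (by simpa using ha))
    have ha1 : a = 1 := by simpa [κ] using congrFun h1 0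
    ext i
    simpa [κ, ha1] using (congrFun h1 i.succ).symm
  have hγL : ∀ u, γ u ∈ linearSet L := fun u => (mk_mem_linearSet (hκ u)).2 (φ (κ u)).2
  have hL'0 : 0 < Module.finrank ℝ L' := by
    have h1 : (h (γ 0)).rep ∈ L' := hmaps (hγL 0)
    refine Module.finrank_pos_iff_exists_ne_zero.2 ⟨⟨_, h1⟩, fun h2 => ?_⟩
    exact (h (γ 0)).rep_nonzero (congrArg Subtype.val h2)
  obtain ⟨n, hn⟩ : ∃ n, Module.finrank ℝ L' = n + 1 := Nat.exists_eq_succ_of_ne_zero hL'0.ne'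
  let ψ : L' ≃ₗ[ℝ] (Fin (n + 1) → ℝ) := LinearEquiv.ofFinrankEq _ _ (by simp [hn])
  obtain ⟨π, hπ⟩ := L'.subtype.exists_leftInverse_of_injective (by simp)
  have hπ' : ∀ x : L', π x = x := fun x => congrArg (fun f : L' →ₗ[ℝ] L' => f x) hπ
  -- Homogeneous coordinates of `L'`, extended to `W` by the left inverse `π`; they separate points
  -- only within `L'`.
  let c : Fin (n + 1) → W →ₗ[ℝ] ℝ := fun i =>
    (LinearMap.proj i).comp (ψ.toLinearMap.comp π)
  have hcext : ∀ x ∈ L', ∀ y ∈ L', (∀ i, c i x = c i y) → x = y := by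
    intro x hx y hy hxy
    have h1 : ψ ⟨x, hx⟩ = ψ ⟨y, hy⟩ := by
      funext i
      have h2 : ψ (π x) i = ψ (π y) i := hxy i
      rwa [hπ' ⟨x, hx⟩, hπ' ⟨y, hy⟩] at h2
    exact congrArg Subtype.val (ψ.injective h1)
  obtain ⟨i₀, hi₀⟩ : ∃ i, c i (h (γ 0)).rep ≠ 0 := by
    by_contra! h1
    exact (h (γ 0)).rep_nonzero
      (hcext _ (hmaps (hγL 0)) 0 L'.zero_mem fun i => by rw [h1, map_zero])
  have hopen : ∀ᶠ u in 𝓝 (0 : EuclideanSpace ℝ (Fin m)), c i₀ (h (γ u)).rep ≠ 0 := by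
    have h1 : Continuous fun u => ‖c i₀ (h (γ u)).rep‖ / ‖(h (γ u)).rep‖ :=
      (continuous_lift_norm_div (LinearMap.toContinuousLinearMap (c i₀))).comp (hc.comp hγ)
    have h2 := h1.continuousAt.eventually_ne (y := (0 : ℝ))
      (div_ne_zero (norm_ne_zero_iff.2 hi₀) (norm_ne_zero_iff.2 (Projectivization.rep_nonzero _)))
    filter_upwards [h2] with u hu h3
    simp [h3] at hu
  obtain ⟨ρ, hρ, hball⟩ := Metric.nhds_basis_closedBall.mem_iff.1 hopen
  have hscale : ∀ u ∈ Metric.closedBall (0 : EuclideanSpace ℝ (Fin m)) 1,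
      c i₀ (h (γ (ρ • u))).rep ≠ 0 := by
    intro u hu
    have h1 : ρ • u ∈ Metric.closedBall (0 : EuclideanSpace ℝ (Fin m)) ρ := by
      rw [mem_closedBall_zero_iff] at hu ⊢
      rw [norm_smul, Real.norm_of_nonneg hρ.le]
      exact mul_le_of_le_one_right hρ.le hu
    exact hball h1
  -- In an affine chart around `h (γ 0)`, with the domain shrunk by `ρ` to stay inside it, `h`
  -- becomes an injection of the unit `m`-ball into `n`-space, with `n < m`.
  let f : EuclideanSpace ℝ (Fin m) → (Fin n → ℝ) := fun u k =>
    formQuotient (c (i₀.succAbove k)) (c i₀) (h (γ (ρ • u)))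
  refine not_injOn_closedBall_of_finrank_lt (f := f) (by simp; omega) ?_ ?_
  · refine continuousOn_pi.2 fun k u hu => ContinuousAt.continuousWithinAt ?_
    refine ContinuousAt.comp (f := fun u => h (γ (ρ • u)))
      (continuousAt_formQuotient _ _ (hscale u hu)) (Continuous.continuousAt ?_)
    exact hc.comp (hγ.comp (continuous_const_smul ρ))
  · intro u hu u' hu' huu
    have h1 := hscale u hu
    have h2 := hscale u' hu'
    refine smul_right_injective _ hρ.ne' (hγinj (hinj ?_))
    have hm1 : (h (γ (ρ • u))).rep ∈ L' := hmaps (hγL _)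
    have hm2 : (h (γ (ρ • u'))).rep ∈ L' := hmaps (hγL _)
    change h (γ (ρ • u)) = h (γ (ρ • u'))
    rw [← Projectivization.mk_rep (h (γ (ρ • u))), ← Projectivization.mk_rep (h (γ (ρ • u'))),
      Projectivization.mk_eq_mk_iff']
    refine ⟨c i₀ (h (γ (ρ • u))).rep / c i₀ (h (γ (ρ • u'))).rep,
      hcext _ (L'.smul_mem _ hm2) _ hm1 fun i => ?_⟩
    rw [map_smul, smul_eq_mul]
    rcases Fin.eq_self_or_eq_succAbove i₀ i with rfl | ⟨k, rfl⟩
    · field_simp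
    · have h3 : c (i₀.succAbove k) (h (γ (ρ • u))).rep / c i₀ (h (γ (ρ • u))).rep =
        c (i₀.succAbove k) (h (γ (ρ • u'))).rep / c i₀ (h (γ (ρ • u'))).rep := congrFun huu k
      rw [div_eq_div_iff h1 h2] at h3
      field_simp
      linarith

end Dimension

/-! ### Block form of an endomorphism -/

section NormalForm

variable {V : Type*} [AddCommGroup V] [Module ℝ V]

/-- The summand of a Lyapunov decomposition with exponent `a`. -/
def LyapunovDecomposition.space {A : Module.End ℝ V} (D : LyapunovDecomposition A) (a : ℝ) :
    Submodule ℝ V := LinearMap.ker (aeval A (D.poly a))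

theorem LyapunovDecomposition.mem_space {A : Module.End ℝ V} (D : LyapunovDecomposition A)
    {a : ℝ} {x : V} : x ∈ D.space a ↔ aeval A (D.poly a) x = 0 := LinearMap.mem_ker

theorem RootsOnLine.comp_X_add_C {p : ℝ[X]} {a : ℝ} (hp : RootsOnLine p a) :
    RootsOnLine (p.comp (X + C a)) 0 := by
  intro z hz
  rw [aeval_comp] at hz
  have := hp _ hz
  simpa using this

theorem LyapunovDecomposition.map_mem_space {A : Module.End ℝ V} (D : LyapunovDecomposition A)
    (a : ℝ) : ∀ x ∈ D.space a, A x ∈ D.space a := by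
  intro x hx
  have h : Commute A (aeval A (D.poly a)) := by
    simpa only [aeval_X] using (Commute.all X (D.poly a)).map (aeval A)
  rw [D.mem_space] at hx ⊢
  rw [← Module.End.mul_apply, ← h.eq, Module.End.mul_apply, hx, map_zero]

theorem aeval_restrict_apply {A : Module.End ℝ V} {L : Submodule ℝ V} (h : ∀ x ∈ L, A x ∈ L)
    (p : ℝ[X]) (x : L) : (aeval (A.restrict h) p x : V) = aeval A p x := by
  induction p using Polynomial.induction_on' generalizing x with
  | add p q hp hq => simp [hp, hq]
  | monomial n c =>
    have hpow : ∀ (n : ℕ), (((A.restrict h) ^ n) x : V) = (A ^ n) x := by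
      intro n
      induction n with
      | zero => simp
      | succ n ih => rw [pow_succ', pow_succ', Module.End.mul_apply, Module.End.mul_apply, ← ih]; rfl
    rw [aeval_monomial, aeval_monomial, Module.End.mul_apply, Module.End.mul_apply, ← hpow]
    simp [Module.algebraMap_end_apply]

/-- The sizes `d` and the enumeration `lam` are given from outside, so that `A` and `B` can be
brought to the same product space. -/
theorem LyapunovDecomposition.exists_normalForm [FiniteDimensional ℝ V] {A : Module.End ℝ V}
    (D : LyapunovDecomposition A) {k : ℕ} {lam : Fin k → ℝ} (hinj : Function.Injective lam)
    (hrange : ∀ a, a ∈ D.exponents ↔ ∃ i, lam i = a) {d : Fin k → ℕ}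
    (hd : ∀ i, Module.finrank ℝ (D.space (lam i)) = d i) :
    ∃ (σ : ∀ i : Fin k, Module.End ℝ (Fin (d i) → ℝ))
      (P : V ≃ₗ[ℝ] (∀ i : Fin k, Fin (d i) → ℝ)),
      (∀ i, HasImaginarySpectrum (σ i)) ∧
      P.conj A = LinearMap.piMap (fun i => lam i • LinearMap.id + σ i) := by
  have hmem : ∀ i, lam i ∈ D.exponents := fun i => (hrange _).2 ⟨i, rfl⟩
  have hexp : D.exponents = Finset.univ.map ⟨lam, hinj⟩ := by
    ext a
    simp [hrange]
  let b : ∀ i, D.space (lam i) ≃ₗ[ℝ] (Fin (d i) → ℝ) := fun i =>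
    LinearEquiv.ofFinrankEq _ _ (by simp [hd])
  let R : ∀ i, Module.End ℝ (D.space (lam i)) := fun i => A.restrict (D.map_mem_space (lam i))
  have hproj : ∀ i x, D.proj (lam i) x ∈ D.space (lam i) := fun i x =>
    D.mem_space.2 (D.aeval_proj _ (hmem i) x)
  let W : V ≃ₗ[ℝ] (∀ i, D.space (lam i)) :=
    { toFun := fun x i => ⟨D.proj (lam i) x, hproj i x⟩
      map_add' := fun x y => by ext; simp
      map_smul' := fun c x => by ext; simp
      invFun := fun y => ∑ i, (y i : V)
      left_inv := fun x => by
        have h := congrArg (fun f : Module.End ℝ V => f x) D.sum_proj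
        rw [hexp] at h
        simpa using h
      right_inv := fun y => by
        ext i
        simp only [map_sum]
        rw [Finset.sum_eq_single i]
        · exact D.proj_of_mem _ (hmem i) _ (D.mem_space.1 (y i).2)
        · intro j _ hji
          exact D.proj_of_ne _ (hmem j) _ (hmem i) (hinj.ne hji) _ (D.mem_space.1 (y j).2)
        · simp }
  refine ⟨fun i => (b i).conj (R i - lam i • LinearMap.id), W.trans (LinearEquiv.piCongrRight b),
    fun i => ?_, ?_⟩
  -- If `p` annihilates the block, then `p(X + λ)` annihilates the block minus `λ`, and its roots
  -- are shifted to the imaginary axis.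
  · refine hasImaginarySpectrum_of_aeval_eq_zero (D.rootsOnLine (lam i)).comp_X_add_C ?_
    have h1 : (b i).conj (R i - lam i • LinearMap.id) + algebraMap ℝ _ (lam i) =
        (b i).conjAlgEquiv ℝ (R i) := by
      refine LinearMap.ext fun x => ?_
      simp [LinearEquiv.conj_apply, Module.algebraMap_end_apply, LinearEquiv.conjAlgEquiv_apply]
    rw [aeval_comp, map_add, aeval_X, aeval_C, h1]
    have h2 : aeval (R i) (D.poly (lam i)) = 0 := by
      ext x
      rw [aeval_restrict_apply]
      exact D.mem_space.1 x.2
    have h3 := Polynomial.aeval_algHom_apply ((b i).conjAlgEquiv ℝ).toAlgHom (R i) (D.poly (lam i))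
    rw [h2, map_zero] at h3
    exact h3
  · have hcomm : ∀ x, (W.trans (LinearEquiv.piCongrRight b)) (A x) =
        LinearMap.piMap (fun i => lam i • LinearMap.id + (b i).conj (R i - lam i • LinearMap.id))
          ((W.trans (LinearEquiv.piCongrRight b)) x) := by
      intro x
      funext i
      have h1 : W (A x) i = R i (W x i) := by
        ext
        exact (LinearMap.congr_fun (D.commute_proj (lam i)).eq x).symm
      simp [LinearEquiv.conj_apply, h1]
    refine LinearMap.ext fun y => ?_
    rw [LinearEquiv.conj_apply_apply, hcomm, LinearEquiv.apply_symm_apply]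

end NormalForm

end ProjFlow

namespace ProjFlow

open Polynomial Filter Topology Set

/-! ### Conjugacy invariants defined by limit points -/

section Flows

variable {X Y : Type*} [TopologicalSpace X] [TopologicalSpace Y]

theorem IsTopConjugacy.symm {φ₁ : Flow ℝ X} {φ₂ : Flow ℝ Y} {h : X ≃ₜ Y}
    (H : IsTopConjugacy φ₁ φ₂ h) : IsTopConjugacy φ₂ φ₁ h.symm := by
  intro t y
  apply h.injective
  rw [H, h.apply_symm_apply, h.apply_symm_apply]

theorem IsTopConjugacy.mapClusterPt {φ₁ : Flow ℝ X} {φ₂ : Flow ℝ Y} {h : X ≃ₜ Y}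
    (H : IsTopConjugacy φ₁ φ₂ h) {l : Filter ℝ} {p q : X}
    (hq : MapClusterPt q l (fun t => φ₁ t p)) : MapClusterPt (h q) l (fun t => φ₂ t (h p)) := by
  have := hq.continuousAt_comp h.continuous.continuousAt
  exact this.congrFun (.of_forall fun t => H t p)

/-- The points which share a limit point of their forward and their backward orbit. -/
def biRecurrentSet (φ : Flow ℝ X) : Set X :=
  {p | ∃ q, MapClusterPt q atTop (fun t => φ t p) ∧ MapClusterPt q atBot (fun t => φ t p)}

theorem IsTopConjugacy.mapsTo_biRecurrentSet {φ₁ : Flow ℝ X} {φ₂ : Flow ℝ Y} {h : X ≃ₜ Y}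
    (H : IsTopConjugacy φ₁ φ₂ h) : MapsTo h (biRecurrentSet φ₁) (biRecurrentSet φ₂) := by
  rintro p ⟨q, hq1, hq2⟩
  exact ⟨h q, H.mapClusterPt hq1, H.mapClusterPt hq2⟩

/-- All limit points along `l` of the orbit of `p` lie in `S`. -/
def LimitsIn (φ : Flow ℝ X) (l : Filter ℝ) (p : X) (S : Set X) : Prop :=
  ∀ q, MapClusterPt q l (fun t => φ t p) → q ∈ S

theorem IsTopConjugacy.limitsIn {φ₁ : Flow ℝ X} {φ₂ : Flow ℝ Y} {h : X ≃ₜ Y}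
    (H : IsTopConjugacy φ₁ φ₂ h) {l : Filter ℝ} {p : X} {S : Set X} {S' : Set Y}
    (hS : MapsTo h S S') (hp : LimitsIn φ₁ l p S) : LimitsIn φ₂ l (h p) S' := by
  intro q hq
  have := H.symm.mapClusterPt hq
  rw [h.symm_apply_apply] at this
  simpa using hS (hp _ this)

theorem LimitsIn.inter_nonempty [CompactSpace X] {φ : Flow ℝ X} {l : Filter ℝ} [l.NeBot] {p : X}
    {S S' : Set X} (h : LimitsIn φ l p S) (h' : LimitsIn φ l p S') : (S ∩ S').Nonempty := by
  obtain ⟨q, hq⟩ := exists_clusterPt_of_compactSpace (map (fun t => φ t p) l)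
  exact ⟨q, h q hq, h' q hq⟩

end Flows

/-! ### Limit points and connecting orbits of the projective flow -/

variable {V : Type*} [NormedAddCommGroup V] [NormedSpace ℝ V] [FiniteDimensional ℝ V]

theorem expMap_apply_ne_zero (A : Module.End ℝ V) (t : ℝ) {x : V} (hx : x ≠ 0) :
    expMap A t x ≠ 0 := fun h => hx (expMap_injective A t (h.trans (map_zero _).symm))

theorem projectiveFlow_mk (A : Module.End ℝ V) (t : ℝ) {x : V} (hx : x ≠ 0) :
    projectiveFlow A t (Projectivization.mk ℝ x hx) =
      Projectivization.mk ℝ (expMap A t x) (expMap_apply_ne_zero A t hx) := rfl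

theorem map_expMap_of_commute {A P : Module.End ℝ V} (h : Commute A P) (t : ℝ) (x : V) :
    P (expMap A t x) = expMap A t (P x) := by
  have : CompleteSpace V := FiniteDimensional.complete ℝ V
  let _ : NormedAlgebra ℚ (V →L[ℝ] V) := NormedAlgebra.restrictScalars ℚ ℝ _
  have h1 : Commute (LinearMap.toContinuousLinearMap A) (LinearMap.toContinuousLinearMap P) := by
    ext y
    exact LinearMap.congr_fun h.eq y
  have h2 : Commute (expMap A t) (LinearMap.toContinuousLinearMap P) :=
    (h1.smul_left t).exp_left
  exact (congrArg (fun f : V →L[ℝ] V => f x) h2.eq).symm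

namespace LyapunovDecomposition

variable {A : Module.End ℝ V} (D : LyapunovDecomposition A)

omit [FiniteDimensional ℝ V] in
theorem sum_proj_apply (x : V) : ∑ a ∈ D.exponents, D.proj a x = x := by
  simpa using congrArg (fun f : Module.End ℝ V => f x) D.sum_proj

omit [FiniteDimensional ℝ V] in
theorem exists_proj_ne_zero {x : V} (hx : x ≠ 0) : ∃ a ∈ D.exponents, D.proj a x ≠ 0 := by
  by_contra! h
  exact hx ((D.sum_proj_apply x).symm.trans (Finset.sum_eq_zero h))

omit [FiniteDimensional ℝ V] in
theorem proj_mem_space {a : ℝ} (ha : a ∈ D.exponents) (x : V) : D.proj a x ∈ D.space a :=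
  D.mem_space.2 (D.aeval_proj a ha x)

omit [FiniteDimensional ℝ V] in
theorem mem_space_of_proj_eq_zero {a : ℝ} (ha : a ∈ D.exponents) {x : V}
    (h : ∀ c ∈ D.exponents, c ≠ a → D.proj c x = 0) : x ∈ D.space a := by
  rw [← D.sum_proj_apply x, Finset.sum_eq_single_of_mem a ha h]
  exact D.proj_mem_space ha x

/-- Limit points of an orbit lie in the summand of the dominating component. -/
theorem limitsIn_of_dominating {l : Filter ℝ} (hl : l ≤ Bornology.cobounded ℝ) {a : ℝ}
    (ha : a ∈ D.exponents) {x : V} (hx : x ≠ 0) (hax : D.proj a x ≠ 0)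
    (hdom : ∀ c ∈ D.exponents, c ≠ a → D.proj c x ≠ 0 →
      ∀ r s, Tendsto (fun t => ‖growthScale a r t / growthScale c s t‖) l (𝓝 0)) :
    LimitsIn (projectiveFlow A) l (Projectivization.mk ℝ x hx) (linearSet (D.space a)) := by
  intro q hq
  refine D.mem_space_of_proj_eq_zero ha fun c hc hca => ?_
  let g : ℝ → V →L[ℝ] V := fun b => LinearMap.toContinuousLinearMap (D.proj b)
  let F : ℙ ℝ V → ℝ := fun p => ‖g c p.rep‖ / ‖p.rep‖
  have hF : ∀ (v : V) (hv : v ≠ 0), F (Projectivization.mk ℝ v hv) = ‖g c v‖ / ‖v‖ := by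
    intro v hv
    obtain ⟨b, hb⟩ := Projectivization.exists_smul_eq_mk_rep ℝ v hv
    have hb' : (b : ℝ) • v = (Projectivization.mk ℝ v hv).rep := hb
    simp only [F, ← hb', map_smul, norm_smul]
    exact mul_div_mul_left _ _ (norm_ne_zero_iff.2 b.ne_zero)
  -- The projections commute with the flow, and `‖exp (t A) x‖` is at least `‖exp (t A) (D.proj a
  -- x)‖` up to the factor `‖g a‖`; so the relative size of the `c`-component tends to zero.
  have hlim : Tendsto (fun t => F (projectiveFlow A t (Projectivization.mk ℝ x hx))) l (𝓝 0) := by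
    have h1 : Tendsto (fun t => ‖expMap A t (D.proj c x)‖ / ‖expMap A t (D.proj a x)‖) l (𝓝 0) := by
      by_cases hcx : D.proj c x = 0
      · simpa [hcx] using tendsto_const_nhds
      · exact tendsto_norm_expMap_div (D.rootsOnLine a) (D.rootsOnLine c) hl (hdom c hc hca hcx)
          (D.aeval_proj a ha x) hax (D.aeval_proj c hc x)
    have h2 := h1.const_mul ‖g a‖
    rw [mul_zero] at h2
    refine squeeze_zero (fun t => by positivity) (fun t => ?_) h2
    rw [projectiveFlow_mk, hF]
    have h3 : g c (expMap A t x) = expMap A t (D.proj c x) :=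
      map_expMap_of_commute (D.commute_proj c) t x
    have h4 : expMap A t (D.proj a x) = g a (expMap A t x) :=
      (map_expMap_of_commute (D.commute_proj a) t x).symm
    have h5 : ‖expMap A t (D.proj a x)‖ ≤ ‖g a‖ * ‖expMap A t x‖ := h4 ▸ (g a).le_opNorm _
    have h6 := norm_pos_iff.2 (expMap_apply_ne_zero A t hx)
    have h7 := norm_pos_iff.2 (expMap_apply_ne_zero A t hax)
    rw [h3, mul_div_assoc', div_le_div_iff₀ h6 h7]
    calc _ ≤ ‖expMap A t (D.proj c x)‖ * (‖g a‖ * ‖expMap A t x‖) := by gcongr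
      _ = _ := by ring
  have hFq : F q = 0 := by
    have h1 := hq.continuousAt_comp (continuous_lift_norm_div (g c)).continuousAt
    have : (𝓝 (F q) ⊓ 𝓝 0).NeBot := ClusterPt.mono h1 hlim
    exact eq_of_nhds_neBot this
  have h2 := (div_eq_zero_iff.1 hFq).resolve_right (norm_ne_zero_iff.2 q.rep_nonzero)
  exact norm_eq_zero.1 h2

theorem limitsIn_atTop {a : ℝ} (ha : a ∈ D.exponents) {x : V} (hx : x ≠ 0)
    (hax : D.proj a x ≠ 0) (hmax : ∀ c ∈ D.exponents, D.proj c x ≠ 0 → c ≤ a) :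
    LimitsIn (projectiveFlow A) atTop (Projectivization.mk ℝ x hx) (linearSet (D.space a)) :=
  D.limitsIn_of_dominating IsOrderBornology.atTop_le_cobounded ha hx hax
    fun c hc hca hcx => tendsto_growthScale_div_atTop (lt_of_le_of_ne (hmax c hc hcx) hca)

theorem limitsIn_atBot {a : ℝ} (ha : a ∈ D.exponents) {x : V} (hx : x ≠ 0)
    (hax : D.proj a x ≠ 0) (hmin : ∀ c ∈ D.exponents, D.proj c x ≠ 0 → a ≤ c) :
    LimitsIn (projectiveFlow A) atBot (Projectivization.mk ℝ x hx) (linearSet (D.space a)) :=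
  D.limitsIn_of_dominating IsOrderBornology.atBot_le_cobounded ha hx hax
    fun c hc hca hcx => tendsto_growthScale_div_atBot (lt_of_le_of_ne (hmin c hc hcx) hca.symm)

omit [FiniteDimensional ℝ V] in
theorem disjoint_linearSet {a b : ℝ} (ha : a ∈ D.exponents) (hb : b ∈ D.exponents) (hab : a ≠ b) :
    Disjoint (linearSet (D.space a)) (linearSet (D.space b)) := by
  rw [Set.disjoint_left]
  intro p hp hq
  have h1 := D.proj_of_mem a ha _ (D.mem_space.1 hp)
  rw [D.proj_of_ne b hb a ha hab.symm _ (D.mem_space.1 hq)] at h1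
  exact p.rep_nonzero h1.symm

omit [FiniteDimensional ℝ V] in
theorem linearSet_nonempty {a : ℝ} (ha : a ∈ D.exponents) :
    (linearSet (D.space a)).Nonempty := by
  obtain ⟨x, hx, hxa⟩ := D.exists_ne_zero a ha
  exact ⟨_, (mk_mem_linearSet hx).2 (D.mem_space.2 hxa)⟩

omit [FiniteDimensional ℝ V] in
theorem exists_max_exponent {x : V} (hx : x ≠ 0) : ∃ a ∈ D.exponents, D.proj a x ≠ 0 ∧
    ∀ c ∈ D.exponents, D.proj c x ≠ 0 → c ≤ a := by
  classical
  obtain ⟨a₀, ha₀, hax₀⟩ := D.exists_proj_ne_zero hx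
  obtain ⟨a, ha, hmax⟩ := (D.exponents.filter fun c => D.proj c x ≠ 0).exists_max_image id
    ⟨a₀, Finset.mem_filter.2 ⟨ha₀, hax₀⟩⟩
  rw [Finset.mem_filter] at ha
  exact ⟨a, ha.1, ha.2, fun c hc hcx => hmax c (Finset.mem_filter.2 ⟨hc, hcx⟩)⟩

omit [FiniteDimensional ℝ V] in
theorem exists_min_exponent {x : V} (hx : x ≠ 0) : ∃ a ∈ D.exponents, D.proj a x ≠ 0 ∧
    ∀ c ∈ D.exponents, D.proj c x ≠ 0 → a ≤ c := by
  classical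
  obtain ⟨a₀, ha₀, hax₀⟩ := D.exists_proj_ne_zero hx
  obtain ⟨a, ha, hmin⟩ := (D.exponents.filter fun c => D.proj c x ≠ 0).exists_min_image id
    ⟨a₀, Finset.mem_filter.2 ⟨ha₀, hax₀⟩⟩
  rw [Finset.mem_filter] at ha
  exact ⟨a, ha.1, ha.2, fun c hc hcx => hmin c (Finset.mem_filter.2 ⟨hc, hcx⟩)⟩

theorem linearSet_subset_biRecurrentSet (a : ℝ) :
    linearSet (D.space a) ⊆ biRecurrentSet (projectiveFlow A) := by
  intro p hp
  induction p using Projectivization.ind with | h x hx =>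
  rw [mk_mem_linearSet, D.mem_space] at hp
  obtain ⟨r, m, M, -, -, v, hv, τ, hτ, h1, h2⟩ :=
    exists_flow_asymptotics (D.rootsOnLine a) hp hx
  have hne : ∀ᶠ n in atTop, τ n ≠ 0 := hτ.eventually_ne_atTop 0
  have h3 := tendsto_mk_of_tendsto_smul (fun n => expMap_apply_ne_zero A (τ n) hx)
    (hne.mono fun n hn => growthScale_ne_zero a r hn) hv h1
  have h4 := tendsto_mk_of_tendsto_smul (fun n => expMap_apply_ne_zero A (-τ n) hx)
    (hne.mono fun n hn => growthScale_ne_zero a r (neg_ne_zero.2 hn)) hv h2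
  exact ⟨Projectivization.mk ℝ v hv, h3.mapClusterPt.of_comp hτ,
    h4.mapClusterPt.of_comp (tendsto_neg_atTop_atBot.comp hτ)⟩

/-- A limit point common to both time directions lies in the summands of both the largest and the
smallest exponent of `x`. These must coincide, which leaves a single component. -/
theorem biRecurrentSet_subset :
    biRecurrentSet (projectiveFlow A) ⊆ ⋃ a ∈ D.exponents, linearSet (D.space a) := by
  rintro p ⟨q, hq1, hq2⟩
  induction p using Projectivization.ind with | h x hx =>
  obtain ⟨a, ha, hax, hmax⟩ := D.exists_max_exponent hx
  obtain ⟨b, hb, hbx, hmin⟩ := D.exists_min_exponent hx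
  have h1 := D.limitsIn_atTop ha hx hax hmax q hq1
  have h2 := D.limitsIn_atBot hb hx hbx hmin q hq2
  have hab : a = b := by
    by_contra h
    exact Set.disjoint_left.1 (D.disjoint_linearSet ha hb h) h1 h2
  refine mem_biUnion ha ((mk_mem_linearSet hx).2 (D.mem_space_of_proj_eq_zero ha ?_))
  intro c hc hca
  by_contra hcx
  exact hca (le_antisymm (hmax c hc hcx) (hab ▸ hmin c hc hcx))

/-- The order of the exponents in terms of connecting orbits. -/
theorem le_iff_exists_limitsIn {a b : ℝ} (ha : a ∈ D.exponents) (hb : b ∈ D.exponents) :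
    b ≤ a ↔ ∃ p, LimitsIn (projectiveFlow A) atTop p (linearSet (D.space a)) ∧
      LimitsIn (projectiveFlow A) atBot p (linearSet (D.space b)) := by
  constructor
  · intro hba
    obtain ⟨x, hx, hxa⟩ := D.exists_ne_zero a ha
    obtain ⟨y, hy, hyb⟩ := D.exists_ne_zero b hb
    rcases eq_or_ne a b with rfl | hab
    · have h1 := D.proj_of_mem a ha x hxa
      have h2 : ∀ c ∈ D.exponents, D.proj c x ≠ 0 → c = a := by
        intro c hc hcx
        by_contra hca
        exact hcx (D.proj_of_ne a ha c hc (Ne.symm hca) x hxa)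
      exact ⟨_, D.limitsIn_atTop ha hx (by rwa [h1]) fun c hc hcx => (h2 c hc hcx).le,
        D.limitsIn_atBot ha hx (by rwa [h1]) fun c hc hcx => (h2 c hc hcx).ge⟩
    -- For `b < a` the line of `x + y` runs from the summand of `b` to that of `a`.
    · have h1 : D.proj a (x + y) = x := by
        rw [map_add, D.proj_of_mem a ha x hxa, D.proj_of_ne b hb a ha hab.symm y hyb, add_zero]
      have h2 : D.proj b (x + y) = y := by
        rw [map_add, D.proj_of_mem b hb y hyb, D.proj_of_ne a ha b hb hab x hxa, zero_add]
      have h3 : ∀ c ∈ D.exponents, D.proj c (x + y) ≠ 0 → c = a ∨ c = b := by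
        intro c hc hcx
        by_contra! hca
        rw [map_add, D.proj_of_ne a ha c hc hca.1.symm x hxa,
          D.proj_of_ne b hb c hc hca.2.symm y hyb, add_zero] at hcx
        exact hcx rfl
      have h0 : x + y ≠ 0 := by
        intro h
        rw [h, map_zero] at h1
        exact hx h1.symm
      refine ⟨_, D.limitsIn_atTop ha h0 (by rwa [h1]) fun c hc hcx => ?_,
        D.limitsIn_atBot hb h0 (by rwa [h2]) fun c hc hcx => ?_⟩
      · rcases h3 c hc hcx with rfl | rfl
        exacts [le_rfl, hba]
      · rcases h3 c hc hcx with rfl | rfl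
        exacts [hba, le_rfl]
  · rintro ⟨p, hp1, hp2⟩
    induction p using Projectivization.ind with | h x hx =>
    obtain ⟨a', ha', hax, hmax⟩ := D.exists_max_exponent hx
    obtain ⟨b', hb', hbx, hmin⟩ := D.exists_min_exponent hx
    -- By compactness the orbit has a limit point, so its limits cannot lie in two disjoint sets.
    have h1 : a' = a := by
      by_contra h
      exact Set.not_disjoint_iff_nonempty_inter.2
        ((D.limitsIn_atTop ha' hx hax hmax).inter_nonempty hp1) (D.disjoint_linearSet ha' ha h)
    have h2 : b' = b := by
      by_contra h
      exact Set.not_disjoint_iff_nonempty_inter.2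
        ((D.limitsIn_atBot hb' hx hbx hmin).inter_nonempty hp2) (D.disjoint_linearSet hb' hb h)
    rw [← h1, ← h2]
    exact hmin a' ha' hax

variable {B : Module.End ℝ V} (D' : LyapunovDecomposition B) {h : ℙ ℝ V ≃ₜ ℙ ℝ V}

/-- The image is connected and is covered by finitely many disjoint closed sets, so it lies in one
of them. -/
theorem exists_mapsTo_linearSet (H : IsTopConjugacy (projectiveFlow A) (projectiveFlow B) h)
    {a : ℝ} (ha : a ∈ D.exponents) :
    ∃ b ∈ D'.exponents, MapsTo h (linearSet (D.space a)) (linearSet (D'.space b)) := by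
  classical
  have hsub : h '' linearSet (D.space a) ⊆ ⋃ b ∈ D'.exponents, linearSet (D'.space b) := by
    rintro _ ⟨p, hp, rfl⟩
    exact D'.biRecurrentSet_subset
      (H.mapsTo_biRecurrentSet (D.linearSet_subset_biRecurrentSet a hp))
  obtain ⟨p, hp⟩ := D.linearSet_nonempty ha
  obtain ⟨b, hb, hpb⟩ := mem_iUnion₂.1 (hsub (mem_image_of_mem h hp))
  refine ⟨b, hb, ?_⟩
  have hpre := (isPreconnected_linearSet (D.space a)).image h h.continuous.continuousOn
  rw [isPreconnected_iff_subset_of_fully_disjoint_closed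
    (h.isClosedMap _ (isClosed_linearSet _))] at hpre
  have hclosed : IsClosed (⋃ c ∈ D'.exponents.erase b, linearSet (D'.space c)) :=
    isClosed_biUnion_finset fun c _ => isClosed_linearSet _
  have hdisj : Disjoint (linearSet (D'.space b))
      (⋃ c ∈ D'.exponents.erase b, linearSet (D'.space c)) := by
    simp only [Set.disjoint_iUnion_right]
    intro c hc
    exact D'.disjoint_linearSet hb (Finset.mem_of_mem_erase hc) (Finset.ne_of_mem_erase hc).symm
  have hcover : h '' linearSet (D.space a) ⊆
      linearSet (D'.space b) ∪ ⋃ c ∈ D'.exponents.erase b, linearSet (D'.space c) := by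
    refine hsub.trans (iUnion₂_subset fun c hc => ?_)
    rcases eq_or_ne c b with rfl | hcb
    · exact subset_union_left
    · exact (subset_biUnion_of_mem (u := fun c => linearSet (D'.space c))
        (Finset.mem_erase.2 ⟨hcb, hc⟩)).trans subset_union_right
  rcases hpre _ _ (isClosed_linearSet _) hclosed hcover hdisj with h1 | h1
  · exact mapsTo_iff_image_subset.2 h1
  · exact absurd (h1 (mem_image_of_mem h hp)) (Set.disjoint_left.1 hdisj hpb)

omit [FiniteDimensional ℝ V] in
theorem eq_of_mapsTo_linearSet {a a' : ℝ} (ha : a ∈ D.exponents) (ha' : a' ∈ D.exponents)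
    (hmaps : ∀ p ∈ linearSet (D.space a), p ∈ linearSet (D.space a')) : a = a' := by
  by_contra hne
  obtain ⟨p, hp⟩ := D.linearSet_nonempty ha
  exact Set.disjoint_left.1 (D.disjoint_linearSet ha ha' hne) hp (hmaps p hp)

/-- A conjugacy of projective flows induces a dimension preserving order isomorphism of the
Lyapunov exponents. -/
theorem exists_orderIso_exponents
    (H : IsTopConjugacy (projectiveFlow A) (projectiveFlow B) h) :
    ∃ e : D.exponents ≃o D'.exponents,
      ∀ a, Module.finrank ℝ (D'.space (e a)) = Module.finrank ℝ (D.space a) := by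
  choose e he using fun a : D.exponents =>
    (D.exists_mapsTo_linearSet D' H a.2 : ∃ b ∈ D'.exponents, _)
  choose f hf using fun b : D'.exponents =>
    (D'.exists_mapsTo_linearSet D H.symm b.2 : ∃ a ∈ D.exponents, _)
  let e' : D.exponents → D'.exponents := fun a => ⟨e a, (he a).1⟩
  let f' : D'.exponents → D.exponents := fun b => ⟨f b, (hf b).1⟩
  have hfe : ∀ a, f' (e' a) = a := fun a => Subtype.ext
    (D.eq_of_mapsTo_linearSet a.2 (hf (e' a)).1 fun p hp => by
      simpa using (hf (e' a)).2 ((he a).2 hp)).symm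
  have hef : ∀ b, e' (f' b) = b := fun b => Subtype.ext
    (D'.eq_of_mapsTo_linearSet b.2 (he (f' b)).1 fun p hp => by
      simpa using (he (f' b)).2 ((hf b).2 hp)).symm
  -- `h` carries an orbit connecting two summands to one connecting their images.
  have hemono : ∀ a b, a ≤ b → e' a ≤ e' b := by
    intro a b hab
    obtain ⟨p, hp1, hp2⟩ := (D.le_iff_exists_limitsIn b.2 a.2).1 hab
    exact (D'.le_iff_exists_limitsIn (he b).1 (he a).1).2
      ⟨h p, H.limitsIn (he b).2 hp1, H.limitsIn (he a).2 hp2⟩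
  have hfmono : ∀ a b, a ≤ b → f' a ≤ f' b := by
    intro a b hab
    obtain ⟨p, hp1, hp2⟩ := (D'.le_iff_exists_limitsIn b.2 a.2).1 hab
    exact (D.le_iff_exists_limitsIn (hf b).1 (hf a).1).2
      ⟨h.symm p, H.symm.limitsIn (hf b).2 hp1, H.symm.limitsIn (hf a).2 hp2⟩
  refine ⟨⟨⟨e', f', hfe, hef⟩, fun {a b} => ⟨fun hab => ?_, hemono a b⟩⟩, fun a => ?_⟩
  · have := hfmono _ _ hab
    simpa only [Equiv.coe_fn_mk, hfe] using this
  · refine le_antisymm ?_ (finrank_le_of_injective_of_mapsTo_linearSet h.continuous h.injective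
      (he a).2)
    have h1 := (hf (e' a)).2
    have h2 : f (e' a) = a := congrArg Subtype.val (hfe a)
    rw [h2] at h1
    exact finrank_le_of_injective_of_mapsTo_linearSet h.symm.continuous h.symm.injective h1

end LyapunovDecomposition

end ProjFlow

theorem proposition2 {V : Type*} [NormedAddCommGroup V] [NormedSpace ℝ V] [FiniteDimensional ℝ V]
    (A B : Module.End ℝ V) (h : ℙ ℝ V ≃ₜ ℙ ℝ V)
    (hconj : ProjFlow.IsTopConjugacy (ProjFlow.projectiveFlow A) (ProjFlow.projectiveFlow B) h) :
    ∃ (k : ℕ) (d : Fin k → ℕ) (lam mu : Fin k → ℝ)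
      (σA σB : ∀ i : Fin k, Module.End ℝ (Fin (d i) → ℝ))
      (P Q : V ≃ₗ[ℝ] (∀ i : Fin k, Fin (d i) → ℝ)),
      (∀ i, 0 < d i) ∧ StrictAnti lam ∧ StrictAnti mu ∧
      (∀ i, ProjFlow.HasImaginarySpectrum (σA i)) ∧
      (∀ i, ProjFlow.HasImaginarySpectrum (σB i)) ∧
      P.conj A = LinearMap.piMap (fun i => lam i • LinearMap.id + σA i) ∧
      Q.conj B = LinearMap.piMap (fun i => mu i • LinearMap.id + σB i) := by
  obtain ⟨D⟩ := ProjFlow.nonempty_lyapunovDecomposition A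
  obtain ⟨D'⟩ := ProjFlow.nonempty_lyapunovDecomposition B
  obtain ⟨e, he⟩ := D.exists_orderIso_exponents D' hconj
  let o : Fin D.exponents.card ≃o D.exponents := D.exponents.orderIsoOfFin rfl
  -- `o` enumerates the exponents increasingly; `Fin.rev` makes the order decreasing.
  let lam : Fin D.exponents.card → ℝ := fun i => o (Fin.rev i)
  let mu : Fin D.exponents.card → ℝ := fun i => e (o (Fin.rev i))
  have hlam : StrictAnti lam := fun i j hij => o.strictMono (Fin.rev_lt_rev.2 hij)
  have hmu : StrictAnti mu := fun i j hij => e.strictMono (o.strictMono (Fin.rev_lt_rev.2 hij))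
  obtain ⟨σA, P, hσA, hP⟩ := D.exists_normalForm (d := fun i => Module.finrank ℝ (D.space (lam i)))
    hlam.injective (fun a => ⟨fun ha => ⟨Fin.rev (o.symm ⟨a, ha⟩), by simp [lam]⟩, by
      rintro ⟨i, rfl⟩; exact (o (Fin.rev i)).2⟩) (fun i => rfl)
  -- The block sizes are those of `A`; `he` identifies them with those of `B`.
  obtain ⟨σB, Q, hσB, hQ⟩ := D'.exists_normalForm (d := fun i => Module.finrank ℝ (D.space (lam i)))
    hmu.injective (fun a => ⟨fun ha => ⟨Fin.rev (o.symm (e.symm ⟨a, ha⟩)), by simp [mu]⟩, by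
      rintro ⟨i, rfl⟩; exact (e (o (Fin.rev i))).2⟩) (fun i => he _)
  refine ⟨_, _, lam, mu, σA, σB, P, Q, fun i => ?_, hlam, hmu, hσA, hσB, hP, hQ⟩
  obtain ⟨x, hx, hxa⟩ := D.exists_ne_zero (lam i) (o (Fin.rev i)).2
  exact Module.finrank_pos_iff_exists_ne_zero.2
    ⟨⟨x, D.mem_space.2 hxa⟩, fun h0 => hx (congrArg Subtype.val h0)⟩

end
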